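/- Let $d\ge 2$, $m\ge 1$ be integers, $Y=(-1/2,1/2)^d$, and let $\omega\subset Y$ be a simply connected domain with Lipschitz boundary and $\mathrm{dist}(\omega,\partial Y)>0$. Let $\mu>0$ and $M\ge 0$. Then there is a constant $\mu_1>0$, depending only on $d,m,\omega,\mu,M$, with the following property. Let $A=(a_{ij}^{\alpha\beta}):\mathbb{R}^d\to\mathbb{R}^{(dm)^2}$, $1\le i,j\le d$, $1\le\alpha,\beta\le m$, be measurable, $\mathbb{Z}^d$-periodic (that is, $A(y+\mathbf n)=A(y)$ for all $y\in\mathbb{R}^d$, $\mathbf n\in\mathbb{Z}^d$) and strongly elliptic, $$\mu|\xi|^2\le a_{ij}^{\alpha\beta}(y)\,\xi_i^\alpha\xi_j^\beta\le\mu^{-1}|\xi|^2\qquad\text{for all } y\in\mathbb{R}^d,\ \xi\in\mathbb{R}^{dm},$$ with $|a_{ij}^{\alpha\beta}(y)-a_{ji}^{\beta\alpha}(y)|\le M$ for all $y,i,j,\alpha,\beta$ (so $M=0$ is the case of symmetric coefficients). Repeated indices are summed. For $\delta\in(0,\infty)$ put $\Lambda_\delta=\delta\mathbf 1_\omega+\mathbf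 1_{Y\setminus\overline\omega}$ on $Y$. For $1\le j\le d$, $1\le\beta\le m$ let $\chi_{\delta,j}^\beta=\big((\chi_{\delta,j}^{\beta})^1,\dots,(\chi_{\delta,j}^{\beta})^m\big)\in H^1(\mathbb{T}^d;\mathbb{R}^m)$ be the solution of the cell problem $$-\mathrm{div}\big(\Lambda_\delta A\nabla(\chi_{\delta,j}^\beta+y_je^\beta)\big)=0\ \text{ weakly on }\mathbb{T}^d=\mathbb{R}^d/\mathbb{Z}^d,\qquad \int_Y\chi_{\delta,j}^\beta\,dy=0,$$ where $e^\beta$ is the $\beta$-th standard basis vector of $\mathbb{R}^m$, and let the homogenized tensor $\widehat A_\delta=(\widehat a_{\delta,ij}^{\alpha\beta})$ be $$\widehat a_{\delta,ij}^{\alpha\beta}=\int_Y\Lambda_\delta(y)\Big[a_{ij}^{\alpha\beta}(y)+a_{ik}^{\alpha\gamma}(y)\,\frac{\partial}{\partial y_k}(\chi_{\delta,j}^{\beta})^\gamma(y)\Big]dy .$$ Then for every $\delta\in(0,\infty)$ the cell problems are solvable, and $$|\widehat A_\delta|\le\mu_1^{-1},\qquad \widehat a_{\delta,ij}^{\alpha\beta}\,\xi_i^\alpha\xi_j^\beta\ge\mu_1|\xi|^2\quad\text{for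 all }\xi\in\mathbb{R}^{dm},$$ where $|\cdot|$ denotes the Euclidean norm. -/

import Mathlib

open MeasureTheory
open scoped BigOperators Matrix

noncomputable section

/-- The open unit cell `Y = (-1/2, 1/2)^d`, a fundamental domain of the flat torus `ℝ^d / ℤ^d`. -/
def unitCell (d : ℕ) : Set (Fin d → ℝ) :=
  {y | ∀ i, -(1 / 2 : ℝ) < y i ∧ y i < 1 / 2}

/-- Periodicity with respect to the lattice `ℤ^d`. -/
def IsLatticePeriodic {d : ℕ} {X : Type*} (f : (Fin d → ℝ) → X) : Prop :=
  ∀ (y : Fin d → ℝ) (n : Fin d → ℤ), f (y + fun i => (n i : ℝ)) = f y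

/-- The open set `U` has Lipschitz boundary: near each boundary point, in suitable rotated Cartesian
coordinates `z = R y`, the set `U` is the region lying strictly above the graph of a Lipschitz
function of the `d - 1` coordinates `z j`, `j ≠ k`. (The balls are those of the sup norm of
`Fin d → ℝ`, and Lipschitz continuity is with respect to the sup norm; by equivalence of norms this
is immaterial.) -/
def HasLipschitzBoundary {d : ℕ} (U : Set (Fin d → ℝ)) : Prop :=
  ∀ x ∈ frontier U, ∃ (r : ℝ) (R : Matrix (Fin d) (Fin d) ℝ) (k : Fin d) (K : NNReal)
    (φ : ({j : Fin d // j ≠ k} → ℝ) → ℝ),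
    0 < r ∧ R ∈ Matrix.orthogonalGroup (Fin d) ℝ ∧ LipschitzWith K φ ∧
      ∀ y ∈ Metric.ball x r, y ∈ U ↔ φ (fun j => (R *ᵥ y) j.1) < (R *ᵥ y) k

/-- The model inclusion: a simply connected domain `ω ⊂ Y` with Lipschitz boundary and positive
distance to `∂Y`. -/
structure IsInclusion {d : ℕ} (ω : Set (Fin d → ℝ)) : Prop where
  isOpen : IsOpen ω
  simplyConnected : IsSimplyConnected ω
  lipschitz : HasLipschitzBoundary ω
  subset_cell : ω ⊆ unitCell d
  dist_pos : ∃ ρ : ℝ, 0 < ρ ∧ ∀ x ∈ ω, ∀ y ∈ frontier (unitCell d), ρ ≤ dist x y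

/-- A tensor `T i j α β`, standing for `T_{ij}^{αβ}`, `1 ≤ i, j ≤ d`, `1 ≤ α, β ≤ m`. -/
abbrev CoeffTensor (d m : ℕ) : Type := Fin d → Fin d → Fin m → Fin m → ℝ

/-- The quadratic form `T_{ij}^{αβ} ξ_i^α ξ_j^β`. -/
def tensorForm {d m : ℕ} (T : CoeffTensor d m) (ξ : Fin d → Fin m → ℝ) : ℝ :=
  ∑ i, ∑ j, ∑ α, ∑ β, T i j α β * ξ i α * ξ j β

/-- `|ξ|²` for `ξ ∈ ℝ^{dm}`. -/
def normSqVec {d m : ℕ} (ξ : Fin d → Fin m → ℝ) : ℝ :=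
  ∑ i, ∑ α, ξ i α ^ 2

/-- The Euclidean norm `|T|` of a tensor, as an element of `ℝ^{(dm)²}`. -/
def tensorNorm {d m : ℕ} (T : CoeffTensor d m) : ℝ :=
  Real.sqrt (∑ i, ∑ j, ∑ α, ∑ β, T i j α β ^ 2)

/-- Strong ellipticity with constant `μ`. -/
def IsStronglyElliptic {d m : ℕ} (μ : ℝ) (A : (Fin d → ℝ) → CoeffTensor d m) : Prop :=
  ∀ (y : Fin d → ℝ) (ξ : Fin d → Fin m → ℝ),
    μ * normSqVec ξ ≤ tensorForm (A y) ξ ∧ tensorForm (A y) ξ ≤ μ⁻¹ * normSqVec ξ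

/-- The skew part of `A` is bounded by `M`; `M = 0` is the symmetry `a_{ij}^{αβ} = a_{ji}^{βα}`. -/
def HasSkewBound {d m : ℕ} (M : ℝ) (A : (Fin d → ℝ) → CoeffTensor d m) : Prop :=
  ∀ (y : Fin d → ℝ) (i j : Fin d) (α β : Fin m), |A y i j α β - A y j i β α| ≤ M

/-- The contrast function `Λ_δ = δ 1_ω + 1_{Y \ closure ω}` on the unit cell. -/
def contrast {d : ℕ} (ω : Set (Fin d → ℝ)) (δ : ℝ) (y : Fin d → ℝ) : ℝ :=
  δ * ω.indicator (fun _ => (1 : ℝ)) y + (unitCell d \ closure ω).indicator (fun _ => (1 : ℝ)) y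

/-- `u ∈ H¹(𝕋^d)` with weak gradient `g = (∂_1 u, …, ∂_d u)`: both are square integrable on the
cell, and integration by parts holds against all smooth functions on the torus, that is, all smooth
`ℤ^d`-periodic functions. A function on `𝕋^d` is represented by its values on `Y`
(the values of `u` and `g` outside `Y` play no role). -/
structure IsTorusH1 {d : ℕ} (u : (Fin d → ℝ) → ℝ) (g : Fin d → (Fin d → ℝ) → ℝ) : Prop where
  memLp : MemLp u 2 (volume.restrict (unitCell d))
  memLp_grad : ∀ i, MemLp (g i) 2 (volume.restrict (unitCell d))
  integral_by_parts : ∀ φ : (Fin d → ℝ) → ℝ, ContDiff ℝ ((⊤ : ℕ∞) : WithTop ℕ∞) φ → IsLatticePeriodic φ →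
    ∀ i, ∫ y in unitCell d, u y * fderiv ℝ φ y (Pi.single i 1)
      = -∫ y in unitCell d, g i y * φ y

/-- `χ = (χ^1, …, χ^m)` with weak gradient `G γ k = ∂_k χ^γ` is the solution in `H¹(𝕋^d; ℝ^m)` of
the cell problem `-div (Λ_δ A ∇(χ + y_j e^β)) = 0` (weakly on the torus), `χ` periodic with
mean zero. Note that `∂_k (y_j e^β)^γ` is `1` if `k = j` and `γ = β`, and `0` otherwise. -/
structure IsCellSolution {d m : ℕ} (A : (Fin d → ℝ) → CoeffTensor d m) (ω : Set (Fin d → ℝ))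
    (δ : ℝ) (j : Fin d) (β : Fin m)
    (χ : Fin m → (Fin d → ℝ) → ℝ) (G : Fin m → Fin d → (Fin d → ℝ) → ℝ) : Prop where
  mem_H1 : ∀ γ, IsTorusH1 (χ γ) (G γ)
  mean_zero : ∀ γ, ∫ y in unitCell d, χ γ y = 0
  weak_eq : ∀ (v : Fin m → (Fin d → ℝ) → ℝ) (V : Fin m → Fin d → (Fin d → ℝ) → ℝ),
    (∀ α, IsTorusH1 (v α) (V α)) →
    ∫ y in unitCell d, contrast ω δ y *
      ∑ i, ∑ k, ∑ α, ∑ γ,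
        A y i k α γ * (G γ k y + if k = j ∧ γ = β then 1 else 0) * V α i y = 0

/-- The homogenized tensor
`â_{ij}^{αβ} = ∫_Y Λ_δ (a_{ij}^{αβ} + a_{ik}^{αγ} ∂_k (χ_j^β)^γ) dy`, computed from the weak
gradients `G j β γ k = ∂_k (χ_j^β)^γ` of the correctors `χ_j^β`. -/
def homogenizedTensor {d m : ℕ} (A : (Fin d → ℝ) → CoeffTensor d m) (ω : Set (Fin d → ℝ))
    (δ : ℝ) (G : Fin d → Fin m → Fin m → Fin d → (Fin d → ℝ) → ℝ) : CoeffTensor d m :=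
  fun i j α β => ∫ y in unitCell d, contrast ω δ y *
    (A y i j α β + ∑ k, ∑ γ, A y i k α γ * G j β γ k y)

end

/-!
# Uniform ellipticity of homogenized tensors with inclusions of arbitrary contrast

The constant must not depend on the contrast `δ ∈ (0, ∞)` inside the inclusion `ω`. The only energy
that does not degenerate as `δ → 0` or `δ → ∞` is the energy outside the inclusion (`outerEnergy`),
and because `ω` stays away from the boundary of the cell, this energy suffices for both bounds. No
extension operator is needed.

*Lower bound.* The quadratic form of the homogenized tensor at `ξ` is the energy of the field
`F = ξ + ∇χ_ξ`, hence at least `μ` times the outer energy of `F`. Since `d ≥ 2`, for each direction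
`k` there is another direction `j`, and a periodic function `φ` of `y_j` alone that is supported in
the slab near `|y_j| = 1/2`, which `ω` does not meet (`slabFun`). As `∂_k φ = 0`, the corrector drops
out of `∫ F_k φ`, so this integral is `ξ_k ∫ φ`; completing a square bounds `ξ_k² ∫ φ` by the outer
energy of `F_k` (`IsTorusH1.slope_le`, `le_tensorForm_homogenizedTensor`).

*Upper bound.* A homogenized coefficient is the energy pairing of `F = e + ∇χ_e` with another constant
field `e'`, to which any periodic gradient may be added (`homogenizedTensor_eq_energyForm`).
Multiplying a coordinate function by a cutoff produces a periodic function whose gradient cancels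
`e'` on `ω` (`exists_flattening`), so that `δ` disappears from the pairing, which is then bounded by a
multiple `μ / 2` of the outer energy of `F` plus a constant (`abs_energyForm_le`). Taking `e' = e` and
absorbing bounds the outer energy of `F`, and then every coefficient (`abs_homogenizedTensor_le`).

*Solvability.* The Lax–Milgram theorem is applied in the space of mean-zero periodic `H¹` functions,
realized as a closed subspace of pairs of a function and a gradient in `L²` (`torusH1`). Coercivity
(`cellForm_coercive`) combines the Poincaré inequality on the torus, which follows from Parseval's
identity (`IsTorusH1.poincare`), with a positive lower bound for the contrast almost everywhere; the
contrast vanishes on the boundary of `ω`, which is null because it is locally a Lipschitz graph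
(`HasLipschitzBoundary.volume_frontier_eq_zero`).
-/

/-! ### The unit cell -/

theorem unitCell_eq_pi (d : ℕ) :
    unitCell d = Set.univ.pi fun _ => Set.Ioo (-(1 / 2 : ℝ)) (1 / 2) := by
  ext y; simp [unitCell]

theorem volume_unitCell (d : ℕ) : volume (unitCell d) = 1 := by
  rw [unitCell_eq_pi, volume_pi_pi]
  norm_num [Real.volume_Ioo]

theorem isOpen_unitCell (d : ℕ) : IsOpen (unitCell d) := by
  rw [unitCell_eq_pi]
  exact isOpen_set_pi Set.finite_univ fun _ _ => isOpen_Ioo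

theorem measurableSet_unitCell (d : ℕ) : MeasurableSet (unitCell d) :=
  (isOpen_unitCell d).measurableSet

instance isProbabilityMeasure_unitCell (d : ℕ) :
    IsProbabilityMeasure (volume.restrict (unitCell d)) :=
  ⟨by rw [Measure.restrict_apply_univ, volume_unitCell]⟩

theorem exists_bound_unitCell {d : ℕ} {v : (Fin d → ℝ) → ℝ} (hv : Continuous v) :
    ∃ C, ∀ᵐ y ∂volume.restrict (unitCell d), ‖v y‖ ≤ C := by
  obtain ⟨C, hC⟩ := (isCompact_Icc (a := fun _ : Fin d => -(1 / 2 : ℝ))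
    (b := fun _ => 1 / 2)).exists_bound_of_continuousOn hv.continuousOn
  refine ⟨C, ae_restrict_of_forall_mem (measurableSet_unitCell d) fun y hy => hC y ?_⟩
  exact ⟨fun i => (hy i).1.le, fun i => (hy i).2.le⟩

theorem memLp_unitCell_of_continuous {d : ℕ} {v : (Fin d → ℝ) → ℝ} (hv : Continuous v) :
    MemLp v 2 (volume.restrict (unitCell d)) := by
  obtain ⟨C, hC⟩ := exists_bound_unitCell hv
  exact MemLp.of_bound hv.aestronglyMeasurable C hC

theorem integrableOn_mul_continuous {d : ℕ} {u v : (Fin d → ℝ) → ℝ}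
    (hu : MemLp u 2 (volume.restrict (unitCell d))) (hv : Continuous v) :
    IntegrableOn (fun y => u y * v y) (unitCell d) :=
  hu.integrable_mul (memLp_unitCell_of_continuous hv)

/-! ### Parseval's identity and the Poincaré inequality -/

/-- The half-open cell `(-1/2, 1/2]^d`, which is in bijection with the torus `(ℝ/ℤ)^d`, agrees with
the open cell up to a null set. -/
theorem restrict_halfOpenCell_eq (d : ℕ) :
    volume.restrict {x : Fin d → ℝ | ∀ i, x i ∈ Set.Ioc (-(1 / 2 : ℝ)) (-(1 / 2) + 1)} =
      volume.restrict (unitCell d) := by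
  apply Measure.restrict_congr_set
  have h1 : unitCell d = Set.univ.pi fun _ => Set.Ioo (-(1 / 2 : ℝ)) (-(1 / 2) + 1) := by
    ext y; norm_num [unitCell]
  have h2 : {x : Fin d → ℝ | ∀ i, x i ∈ Set.Ioc (-(1 / 2 : ℝ)) (-(1 / 2) + 1)} =
      Set.univ.pi fun _ => Set.Ioc (-(1 / 2 : ℝ)) (-(1 / 2) + 1) := by
    ext y; simp
  rw [h1, h2]
  exact (Measure.univ_pi_Ioc_ae_eq_Icc (μ := fun _ : Fin d => (volume : Measure ℝ))).trans
    (Measure.univ_pi_Ioo_ae_eq_Icc (μ := fun _ : Fin d => (volume : Measure ℝ))).symm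

/-- Parseval's identity on the cell, transported from the torus. -/
theorem hasSum_sq_mFourier_unitCell {d : ℕ} {u : (Fin d → ℝ) → ℂ}
    (hu : MemLp u 2 (volume.restrict (unitCell d))) :
    HasSum (fun n : Fin d → ℤ => ‖∫ y in unitCell d,
        UnitAddTorus.mFourier (-n) (fun i => (y i : UnitAddCircle)) • u y‖ ^ 2)
      (∫ y in unitCell d, ‖u y‖ ^ 2) := by
  let b : Fin d → ℝ := fun _ => -(1 / 2)
  -- Mathlib's Fourier theory on the torus is stated for the product of these Haar measures.
  let _ : MeasureSpace UnitAddCircle := ⟨AddCircle.haarAddCircle⟩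
  let B : Set (Fin d → ℝ) := {x | ∀ i, x i ∈ Set.Ioc (b i) (b i + 1)}
  have hBm : MeasurableSet B := by
    have := MeasurableSet.univ_pi' (fun i : Fin d => measurableSet_Ioc (a := b i) (b := b i + 1))
    exact this
  have hB : volume.restrict B = volume.restrict (unitCell d) := restrict_halfOpenCell_eq d
  rw [← hB] at hu ⊢
  let u' : UnitAddTorus (Fin d) → ℂ := fun t => u (UnitAddTorus.measurableEquivPiIoc b t).1
  have hu'u : ∀ x ∈ B, u' (fun i => (x i : UnitAddCircle)) = u x := by
    intro x hx
    have := (UnitAddTorus.measurableEquivPiIoc b).apply_symm_apply ⟨x, hx⟩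
    rw [UnitAddTorus.coe_symm_measurableEquivPiIoc_apply] at this
    simp only [u']
    rw [this]
  have hmp : MeasurePreserving (fun t => (UnitAddTorus.measurableEquivPiIoc b t).1)
      (volume : Measure (UnitAddTorus (Fin d))) (volume.restrict B) := by
    refine MeasurePreserving.comp ?_ (UnitAddTorus.measurePreserving_equivPiIoc b)
    exact ⟨measurable_subtype_coe, map_comap_subtype_coe hBm volume⟩
  have hu' : MemLp u' 2 volume := hu.comp_measurePreserving hmp
  have key := UnitAddTorus.hasSum_sq_mFourierCoeff hu'.toLp
  have h1 : ∀ n, UnitAddTorus.mFourierCoeff (hu'.toLp : UnitAddTorus (Fin d) → ℂ) n =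
      ∫ y in B, UnitAddTorus.mFourier (-n) (fun i => (y i : UnitAddCircle)) • u y := by
    intro n
    have : UnitAddTorus.mFourierCoeff (hu'.toLp : UnitAddTorus (Fin d) → ℂ) n =
        UnitAddTorus.mFourierCoeff u' n := by
      apply integral_congr_ae
      filter_upwards [hu'.coeFn_toLp] with t ht
      rw [ht]
    rw [this, UnitAddTorus.mFourierCoeff_eq_integral _ n b]
    refine setIntegral_congr_fun hBm fun x hx => ?_
    simp only [hu'u x hx]
  have h2 : ∫ t, ‖(hu'.toLp : UnitAddTorus (Fin d) → ℂ) t‖ ^ 2 = ∫ y in B, ‖u y‖ ^ 2 := by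
    have : ∫ t, ‖(hu'.toLp : UnitAddTorus (Fin d) → ℂ) t‖ ^ 2 = ∫ t, ‖u' t‖ ^ 2 := by
      apply integral_congr_ae
      filter_upwards [hu'.coeFn_toLp] with t ht
      rw [ht]
    rw [this, UnitAddTorus.integral_preimage _ b]
    refine setIntegral_congr_fun hBm fun x hx => ?_
    simp only [hu'u x hx]
  rw [h2] at key
  simpa only [h1] using key

/-- The phase `2π n · y` of the Fourier mode with frequency `n`. -/
noncomputable def phase {d : ℕ} (n : Fin d → ℤ) (y : Fin d → ℝ) : ℝ :=
  2 * Real.pi * ∑ i, (n i : ℝ) * y i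

theorem mFourier_coe_eq {d : ℕ} (n : Fin d → ℤ) (y : Fin d → ℝ) :
    UnitAddTorus.mFourier n (fun i => (y i : UnitAddCircle)) =
      Complex.exp (phase n y * Complex.I) := by
  simp only [UnitAddTorus.mFourier, ContinuousMap.coe_mk, fourier_coe_apply, phase]
  rw [← Complex.exp_sum]
  congr 1
  push_cast
  rw [Finset.mul_sum, Finset.sum_mul]
  refine Finset.sum_congr rfl fun i _ => ?_
  ring

theorem contDiff_phase {d : ℕ} (n : Fin d → ℤ) {k : WithTop ℕ∞} : ContDiff ℝ k (phase n) := by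
  unfold phase
  fun_prop

theorem hasFDerivAt_phase {d : ℕ} (n : Fin d → ℤ) (y : Fin d → ℝ) :
    HasFDerivAt (phase n) ((2 * Real.pi) •
      ∑ i, (n i : ℝ) • ContinuousLinearMap.proj (R := ℝ) (φ := fun _ : Fin d => ℝ) i) y := by
  unfold phase
  refine HasFDerivAt.const_mul ?_ _
  refine HasFDerivAt.fun_sum fun i _ => ?_
  exact (hasFDerivAt_apply i y).const_mul _

theorem phase_add_int {d : ℕ} (n : Fin d → ℤ) (y : Fin d → ℝ) (k : Fin d → ℤ) :
    phase n (y + fun i => (k i : ℝ)) = phase n y + ((∑ i, n i * k i : ℤ) : ℝ) * (2 * Real.pi) := by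
  simp only [phase, Pi.add_apply, mul_add, Finset.sum_add_distrib]
  push_cast
  ring

/-- Parseval's identity for real functions, in terms of sines and cosines. -/
theorem hasSum_sq_cos_sin {d : ℕ} {u : (Fin d → ℝ) → ℝ}
    (hu : MemLp u 2 (volume.restrict (unitCell d))) :
    HasSum (fun n : Fin d → ℤ => (∫ y in unitCell d, u y * Real.cos (phase n y)) ^ 2 +
        (∫ y in unitCell d, u y * Real.sin (phase n y)) ^ 2)
      (∫ y in unitCell d, u y ^ 2) := by
  have key := hasSum_sq_mFourier_unitCell (u := fun y => (u y : ℂ)) hu.ofReal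
  have hc : ∀ n, Continuous (phase (d := d) n) := fun n => (contDiff_phase n (k := 0)).continuous
  have e1 : ∀ n : Fin d → ℤ, ‖∫ y in unitCell d,
        UnitAddTorus.mFourier (-n) (fun i => (y i : UnitAddCircle)) • (u y : ℂ)‖ ^ 2 =
      (∫ y in unitCell d, u y * Real.cos (phase n y)) ^ 2 +
        (∫ y in unitCell d, u y * Real.sin (phase n y)) ^ 2 := by
    intro n
    have hi1 := integrableOn_mul_continuous hu (Real.continuous_cos.comp (hc n))
    have hi2 := integrableOn_mul_continuous hu (Real.continuous_sin.comp (hc n))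
    have : ∫ y in unitCell d,
        UnitAddTorus.mFourier (-n) (fun i => (y i : UnitAddCircle)) • (u y : ℂ) =
        ((∫ y in unitCell d, u y * Real.cos (phase n y) : ℝ) : ℂ) -
          ((∫ y in unitCell d, u y * Real.sin (phase n y) : ℝ) : ℂ) * Complex.I := by
      rw [← integral_complex_ofReal, ← integral_complex_ofReal, ← integral_mul_const,
        ← integral_sub (by exact hi1.ofReal) (by exact hi2.ofReal.mul_const _)]
      refine integral_congr_ae (Filter.Eventually.of_forall fun y => ?_)
      have hp : phase (-n) y = -phase n y := by simp [phase]
      simp only [mFourier_coe_eq, hp, smul_eq_mul]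
      rw [Complex.exp_mul_I]
      push_cast
      rw [Complex.cos_neg, Complex.sin_neg]
      ring
    rw [this, ← Complex.normSq_eq_norm_sq]
    simp [Complex.normSq_apply]
    ring
  have e2 : ∀ y, ‖(u y : ℂ)‖ ^ 2 = u y ^ 2 := fun y => by simp
  simpa only [e1, e2] using key

/-- Differentiation multiplies the Fourier coefficients by `2π n_i`: integrate by parts against the
sine and the cosine of the phase. -/
theorem IsTorusH1.sq_coeff_grad {d : ℕ} {u : (Fin d → ℝ) → ℝ} {g : Fin d → (Fin d → ℝ) → ℝ}
    (h : IsTorusH1 u g) (n : Fin d → ℤ) (i : Fin d) :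
    (∫ y in unitCell d, g i y * Real.cos (phase n y)) ^ 2 +
        (∫ y in unitCell d, g i y * Real.sin (phase n y)) ^ 2 =
      (2 * Real.pi * n i) ^ 2 * ((∫ y in unitCell d, u y * Real.cos (phase n y)) ^ 2 +
        (∫ y in unitCell d, u y * Real.sin (phase n y)) ^ 2) := by
  have hd : ((2 * Real.pi) • ∑ i, (n i : ℝ) •
      ContinuousLinearMap.proj (R := ℝ) (φ := fun _ : Fin d => ℝ) i) (Pi.single i 1) =
      2 * Real.pi * n i := by
    simp [Pi.single_apply]
  have h1 := h.integral_by_parts (fun y => Real.cos (phase n y))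
    (Real.contDiff_cos.comp (contDiff_phase n))
    (fun y k => by simp only [phase_add_int, Real.cos_add_int_mul_two_pi]) i
  have h2 := h.integral_by_parts (fun y => Real.sin (phase n y))
    (Real.contDiff_sin.comp (contDiff_phase n))
    (fun y k => by simp only [phase_add_int, Real.sin_add_int_mul_two_pi]) i
  have f1 : ∀ y, u y * fderiv ℝ (fun y => Real.cos (phase n y)) y (Pi.single i 1) =
      -(2 * Real.pi * n i) * (u y * Real.sin (phase n y)) := by
    intro y
    rw [((hasFDerivAt_phase n y).cos).fderiv, smul_apply, hd, smul_eq_mul]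
    ring
  have f2 : ∀ y, u y * fderiv ℝ (fun y => Real.sin (phase n y)) y (Pi.single i 1) =
      (2 * Real.pi * n i) * (u y * Real.cos (phase n y)) := by
    intro y
    rw [((hasFDerivAt_phase n y).sin).fderiv, smul_apply, hd, smul_eq_mul]
    ring
  simp only [f1, f2, integral_const_mul] at h1 h2
  have h1' : ∫ y in unitCell d, g i y * Real.cos (phase n y) =
      (2 * Real.pi * n i) * ∫ y in unitCell d, u y * Real.sin (phase n y) := by linarith
  have h2' : ∫ y in unitCell d, g i y * Real.sin (phase n y) =
      -((2 * Real.pi * n i) * ∫ y in unitCell d, u y * Real.cos (phase n y)) := by linarith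
  rw [h1', h2']
  ring

/-- The Poincaré inequality on the torus. By Parseval it reduces to `1 ≤ (2π n_i)²` for some `i`
at every nonzero frequency `n`. -/
theorem IsTorusH1.poincare {d : ℕ} {u : (Fin d → ℝ) → ℝ} {g : Fin d → (Fin d → ℝ) → ℝ}
    (h : IsTorusH1 u g) (h0 : ∫ y in unitCell d, u y = 0) :
    ∫ y in unitCell d, u y ^ 2 ≤ ∑ i, ∫ y in unitCell d, g i y ^ 2 := by
  refine hasSum_le ?_ (hasSum_sq_cos_sin h.memLp)
    (hasSum_sum fun i _ => hasSum_sq_cos_sin (h.memLp_grad i))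
  intro n
  simp only [h.sq_coeff_grad, ← Finset.sum_mul]
  -- The zero frequency is the mean, which vanishes.
  by_cases hn : n = 0
  · subst hn
    have : ∀ y, phase (0 : Fin d → ℤ) y = 0 := by simp [phase]
    simp [this, h0]
  · obtain ⟨i, hi⟩ := Function.ne_iff.mp hn
    refine le_mul_of_one_le_left (by positivity) ?_
    refine le_trans ?_ (Finset.single_le_sum (f := fun i => (2 * Real.pi * n i) ^ 2)
      (fun _ _ => sq_nonneg _) (Finset.mem_univ i))
    have h1 : (1 : ℝ) ≤ (n i : ℝ) ^ 2 := by
      have hi' : n i ≠ 0 := hi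
      have : (1 : ℤ) ≤ n i ^ 2 := by
        have := sq_pos_of_ne_zero hi'
        omega
      exact_mod_cast this
    have h2 := Real.pi_gt_three
    rw [mul_pow]
    nlinarith [h1, h2, mul_nonneg (sub_nonneg.2 h1) (sq_nonneg (2 * Real.pi))]

/-! ### The boundary of the inclusion -/

/-- A graph over the rotated coordinates other than the `k`-th one is disjoint from its translates
in the `k`-th rotated direction, hence null. -/
theorem volume_rotatedGraph_eq_zero {d : ℕ} {R : Matrix (Fin d) (Fin d) ℝ}
    (hR : R ∈ Matrix.orthogonalGroup (Fin d) ℝ) (k : Fin d)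
    {φ : ({j : Fin d // j ≠ k} → ℝ) → ℝ} (hφ : Continuous φ) :
    volume {y : Fin d → ℝ | φ (fun j => (R *ᵥ y) j.1) = (R *ᵥ y) k} = 0 := by
  have hRc : Continuous fun y : Fin d → ℝ => R *ᵥ y := by fun_prop
  have hmeas : MeasurableSet {y : Fin d → ℝ | φ (fun j => (R *ᵥ y) j.1) = (R *ᵥ y) k} := by
    refine (isClosed_eq (hφ.comp (continuous_pi fun j => ?_)) ?_).measurableSet
    · exact (continuous_apply _).comp hRc
    · exact (continuous_apply _).comp hRc
  let e : Fin d → ℝ := Rᵀ *ᵥ Pi.single k 1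
  have hRe : R *ᵥ e = Pi.single k 1 := by
    have : R * Rᵀ = 1 := (Matrix.mem_orthogonalGroup_iff (Fin d) ℝ).mp hR
    simp only [e, Matrix.mulVec_mulVec, this, Matrix.one_mulVec]
  refine Measure.addHaar_eq_zero_of_disjoint_translates volume
    (fun n : ℕ => ((n : ℝ) + 1)⁻¹ • e) ?_ ?_ hmeas
  · refine (isBounded_iff_forall_norm_le.mpr ⟨‖e‖, ?_⟩)
    rintro _ ⟨n, rfl⟩
    rw [norm_smul, Real.norm_of_nonneg (by positivity)]
    exact mul_le_of_le_one_left (norm_nonneg _)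
      (inv_le_one_of_one_le₀ (by linarith [n.cast_nonneg (α := ℝ)]))
  · intro m n hmn
    refine Set.disjoint_left.mpr ?_
    rintro y hm hn
    simp only [Set.singleton_add, Set.mem_image, Set.mem_ofPred_eq] at hm hn
    obtain ⟨s, hs, rfl⟩ := hm
    obtain ⟨t, ht, hst⟩ := hn
    apply hmn
    have hst' := congrArg (fun y => R *ᵥ y) hst
    simp only [Matrix.mulVec_add, Matrix.mulVec_smul, hRe] at hst'
    have h1 : (fun j : {j : Fin d // j ≠ k} => (R *ᵥ t) j.1) = fun j => (R *ᵥ s) j.1 := by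
      ext j
      have := congrFun hst' j.1
      simpa [Pi.single_eq_of_ne j.2] using this
    have h2 := congrFun hst' k
    simp only [Pi.add_apply, Pi.smul_apply, Pi.single_eq_same, smul_eq_mul, mul_one] at h2
    rw [← ht, ← hs, h1] at h2
    have h3 : ((n : ℝ) + 1)⁻¹ = ((m : ℝ) + 1)⁻¹ := by linarith
    have h4 : (n : ℝ) + 1 = (m : ℝ) + 1 := inv_injective h3
    exact_mod_cast (by linarith : (m : ℝ) = n)

theorem HasLipschitzBoundary.volume_frontier_eq_zero {d : ℕ} {U : Set (Fin d → ℝ)}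
    (hU : HasLipschitzBoundary U) : volume (frontier U) = 0 := by
  refine measure_null_of_locally_null _ fun x hx => ?_
  obtain ⟨r, R, k, K, φ, hr, hR, hφ, h⟩ := hU x hx
  refine ⟨frontier U ∩ Metric.ball x r,
    Filter.inter_mem self_mem_nhdsWithin (mem_nhdsWithin_of_mem_nhds (Metric.ball_mem_nhds x hr)),
    measure_mono_null ?_ (volume_rotatedGraph_eq_zero hR k hφ.continuous)⟩
  have hRc : Continuous fun y : Fin d → ℝ => R *ᵥ y := by fun_prop
  have c1 : Continuous fun y : Fin d → ℝ => φ (fun j => (R *ᵥ y) j.1) :=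
    hφ.continuous.comp (continuous_pi fun j => (continuous_apply _).comp hRc)
  have c2 : Continuous fun y : Fin d → ℝ => (R *ᵥ y) k := (continuous_apply _).comp hRc
  rintro y ⟨hy, hyr⟩
  have hb : Metric.ball x r ∈ nhds y := Metric.isOpen_ball.mem_nhds hyr
  rcases lt_trichotomy (φ (fun j => (R *ᵥ y) j.1)) ((R *ᵥ y) k) with hlt | heq | hgt
  · exfalso
    refine hy.2 (mem_interior_iff_mem_nhds.mpr ?_)
    filter_upwards [hb, (isOpen_lt c1 c2).mem_nhds hlt] with z hz hz'
    exact (h z hz).mpr hz'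
  · exact heq
  · exfalso
    have : Uᶜ ∈ nhds y := by
      filter_upwards [hb, (isOpen_lt c2 c1).mem_nhds hgt] with z hz hz'
      exact fun hzU => lt_asymm hz' ((h z hz).mp hzU)
    exact (mem_closure_iff_nhds.mp hy.1 _ this).elim fun z hz => hz.1 hz.2

/-- An inclusion keeps away from the boundary of the cell, hence lies in a smaller concentric
cube (a ball of the sup norm). -/
theorem IsInclusion.exists_closedBall {d : ℕ} {ω : Set (Fin d → ℝ)} (hω : IsInclusion ω) :
    ∃ r : ℝ, 0 < r ∧ r < 1 / 2 ∧ ω ⊆ Metric.closedBall 0 r := by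
  obtain ⟨ρ, hρ, h⟩ := hω.dist_pos
  -- The value `1 / 4` only makes the radius positive.
  refine ⟨max (1 / 4) (1 / 2 - ρ), by positivity, by simp; constructor <;> linarith, ?_⟩
  intro x hx
  rw [mem_closedBall_zero_iff, pi_norm_le_iff_of_nonneg (by positivity)]
  intro i
  refine le_max_of_le_right ?_
  have hxY := hω.subset_cell hx
  have hcl : closure (unitCell d) = Set.univ.pi fun _ => Set.Icc (-(1 / 2 : ℝ)) (1 / 2) := by
    rw [unitCell_eq_pi, closure_pi_set]
    simp only [closure_Ioo (show -(1 / 2 : ℝ) ≠ 1 / 2 by norm_num)]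
  -- Moving the `i`-th coordinate to `±1/2` gives a point of the boundary of the cell.
  have key : ∀ s : ℝ, |s| = 1 / 2 → ρ ≤ |x i - s| := by
    intro s hs
    have hf : Function.update x i s ∈ frontier (unitCell d) := by
      refine ⟨?_, fun hi => ?_⟩
      · rw [hcl]
        intro j _
        by_cases hj : j = i
        · subst hj
          simpa using abs_le.mp hs.le
        · rw [Function.update_of_ne hj]
          exact ⟨(hxY j).1.le, (hxY j).2.le⟩
      · have := interior_subset hi i
        rw [Function.update_self, ← abs_lt] at this
        linarith
    refine (h x hx _ hf).trans ((dist_pi_le_iff (abs_nonneg _)).mpr fun j => ?_)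
    by_cases hj : j = i
    · subst hj
      simp [Real.dist_eq]
    · simp [Function.update_of_ne hj]
  have h1 := key (1 / 2) (by norm_num)
  have h2 := key (-(1 / 2)) (by norm_num)
  have := hxY i
  rw [abs_of_neg (by linarith)] at h1
  rw [abs_of_pos (by linarith)] at h2
  rw [Real.norm_eq_abs, abs_le]
  constructor <;> linarith

/-! ### Test functions supported off the inclusion -/

/-- A smooth function with compact support in the cell, extended periodically, lies in
`H¹(𝕋^d)`. -/
theorem isTorusH1_of_hasCompactSupport {d : ℕ} {w : (Fin d → ℝ) → ℝ} (hw : ContDiff ℝ 1 w)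
    (hc : HasCompactSupport w) (hs : tsupport w ⊆ unitCell d) :
    IsTorusH1 w fun i y => fderiv ℝ w y (Pi.single i 1) := by
  have hdc : ∀ i : Fin d, Continuous fun y => fderiv ℝ w y (Pi.single i 1) := fun i =>
    (hw.continuous_fderiv one_ne_zero).clm_apply continuous_const
  have hds : ∀ i : Fin d, HasCompactSupport fun y => fderiv ℝ w y (Pi.single i 1) := fun i =>
    hc.fderiv_apply ℝ _
  refine ⟨(hw.continuous.memLp_of_hasCompactSupport hc).restrict _,
    fun i => ((hdc i).memLp_of_hasCompactSupport (hds i)).restrict _, fun φ hφ _ i => ?_⟩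
  have hφd : Continuous fun y => fderiv ℝ φ y (Pi.single i 1) :=
    (hφ.continuous_fderiv (by simp)).clm_apply continuous_const
  rw [setIntegral_eq_integral_of_forall_compl_eq_zero,
    setIntegral_eq_integral_of_forall_compl_eq_zero]
  · refine integral_mul_fderiv_eq_neg_fderiv_mul_of_integrable ?_ ?_ ?_ ?_ ?_
    · exact ((hdc i).mul hφ.continuous).integrable_of_hasCompactSupport (hds i).mul_right
    · exact (hw.continuous.mul hφd).integrable_of_hasCompactSupport hc.mul_right
    · exact (hw.continuous.mul hφ.continuous).integrable_of_hasCompactSupport hc.mul_right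
    · exact fun x _ => (hw.differentiable one_ne_zero) x
    · exact fun x _ => (hφ.differentiable (by simp)) x
  · intro x hx
    have : fderiv ℝ w x = 0 := by
      have h1 : x ∉ tsupport (fderiv ℝ w) := fun h => hx (hs (tsupport_fderiv_subset ℝ h))
      exact image_eq_zero_of_notMem_tsupport h1
    simp [this]
  · intro x hx
    simp [image_eq_zero_of_notMem_tsupport fun h => hx (hs h)]

/-- A periodic function of the single variable `y_j`, supported in the part `|y_j| > r` of the
cell, where `cos (2π y_j) < cos (2π r)`. -/
noncomputable def slabFun {d : ℕ} (r : ℝ) (j : Fin d) (y : Fin d → ℝ) : ℝ :=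
  Real.smoothTransition (Real.cos (2 * Real.pi * r) - Real.cos (2 * Real.pi * y j))

theorem slabFun_nonneg {d : ℕ} (r : ℝ) (j : Fin d) (y : Fin d → ℝ) : 0 ≤ slabFun r j y :=
  Real.smoothTransition.nonneg _

theorem slabFun_le_one {d : ℕ} (r : ℝ) (j : Fin d) (y : Fin d → ℝ) : slabFun r j y ≤ 1 :=
  Real.smoothTransition.le_one _

theorem contDiff_slabFun {d : ℕ} (r : ℝ) (j : Fin d) {n : ℕ∞} : ContDiff ℝ n (slabFun r j) := by
  refine Real.smoothTransition.contDiff.comp (contDiff_const.sub (Real.contDiff_cos.comp ?_))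
  fun_prop

theorem slabFun_periodic {d : ℕ} (r : ℝ) (j : Fin d) : IsLatticePeriodic (slabFun r j) := by
  intro y n
  have : 2 * Real.pi * (y j + n j) = 2 * Real.pi * y j + n j * (2 * Real.pi) := by ring
  simp only [slabFun, Pi.add_apply, this, Real.cos_add_int_mul_two_pi]

theorem fderiv_slabFun {d : ℕ} (r : ℝ) {i j : Fin d} (hij : i ≠ j) (y : Fin d → ℝ) :
    fderiv ℝ (slabFun r j) y (Pi.single i 1) = 0 := by
  have hd : DifferentiableAt ℝ (slabFun r j) y :=
    ((contDiff_slabFun r j (n := 1)).differentiable (by simp)) y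
  rw [← hd.lineDeriv_eq_fderiv, lineDeriv]
  have : (fun t : ℝ => slabFun r j (y + t • Pi.single i 1)) = fun _ => slabFun r j y := by
    ext t
    simp [slabFun, Pi.single_eq_of_ne hij.symm]
  rw [this, deriv_const]

theorem slabFun_eq_zero {d : ℕ} {r : ℝ} (hr : r < 1 / 2) {j : Fin d} {y : Fin d → ℝ}
    (hy : |y j| ≤ r) : slabFun r j y = 0 := by
  have hpi := Real.pi_pos
  refine Real.smoothTransition.zero_of_nonpos (sub_nonpos.mpr ?_)
  rw [← Real.cos_abs (2 * Real.pi * y j), abs_mul, abs_of_pos (by positivity)]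
  refine Real.cos_le_cos_of_nonneg_of_le_pi (by positivity) (by nlinarith) ?_
  gcongr

theorem slabFun_pos {d : ℕ} {r : ℝ} (hr0 : 0 < r) {j : Fin d} {y : Fin d → ℝ}
    (h1 : r < y j) (h2 : y j < 1 / 2) : 0 < slabFun r j y := by
  have hpi := Real.pi_pos
  refine Real.smoothTransition.pos_of_pos (sub_pos.mpr ?_)
  refine Real.cos_lt_cos_of_nonneg_of_le_pi (by positivity) (by nlinarith) ?_
  gcongr

theorem integrableOn_slabFun {d : ℕ} (r : ℝ) (j : Fin d) :
    IntegrableOn (slabFun r j) (unitCell d) := by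
  exact (memLp_unitCell_of_continuous (contDiff_slabFun r j (n := 0)).continuous).integrable
    (by norm_num)

theorem integral_slabFun_pos {d : ℕ} {r : ℝ} (hr0 : 0 < r) (hr : r < 1 / 2) (j : Fin d) :
    0 < ∫ y in unitCell d, slabFun r j y := by
  rw [setIntegral_pos_iff_support_of_nonneg_ae
    (Filter.Eventually.of_forall (slabFun_nonneg r j))
    (integrableOn_slabFun r j)]
  have ho : IsOpen ({y : Fin d → ℝ | r < y j} ∩ unitCell d) :=
    (isOpen_lt continuous_const (continuous_apply j)).inter (isOpen_unitCell d)
  refine (ho.measure_pos volume ⟨fun _ => (r + 1 / 2) / 2, ?_, fun i => ?_⟩).trans_le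
    (measure_mono fun y hy => ⟨(slabFun_pos hr0 hy.1 (hy.2 j).2).ne', hy.2⟩)
  · simp only [Set.mem_ofPred_eq]; linarith
  · constructor <;> linarith

/-- On the slab where `slabFun r j` lives there is no inclusion, and `∂_i u` has mean zero against
a periodic function of `y_j` when `i ≠ j`. Hence an affine slope `t` in the direction `i` costs
energy outside the inclusion. -/
theorem IsTorusH1.slope_le {d : ℕ} {u : (Fin d → ℝ) → ℝ} {g : Fin d → (Fin d → ℝ) → ℝ}
    (h : IsTorusH1 u g) {ω : Set (Fin d → ℝ)} {r : ℝ} (hr : r < 1 / 2)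
    (hω : ω ⊆ Metric.closedBall 0 r) {i j : Fin d} (hij : i ≠ j) (t : ℝ) :
    t ^ 2 * ∫ y in unitCell d, slabFun r j y ≤
      ∫ y in unitCell d, (unitCell d \ closure ω).indicator (fun y => (g i y + t) ^ 2) y := by
  have hi1 := integrableOn_slabFun r j
  have hc : Continuous (slabFun r j) := (contDiff_slabFun r j (n := 0)).continuous
  have hi2 := integrableOn_mul_continuous (h.memLp_grad i) hc
  have h0 : ∫ y in unitCell d, g i y * slabFun r j y = 0 := by
    have := h.integral_by_parts (slabFun r j) (contDiff_slabFun r j) (slabFun_periodic r j) i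
    simp only [fderiv_slabFun r hij, mul_zero, integral_zero] at this
    linarith
  have hm : MeasurableSet (unitCell d \ closure ω) :=
    (measurableSet_unitCell d).diff isClosed_closure.measurableSet
  have hsq : MemLp (fun y => g i y + t) 2 (volume.restrict (unitCell d)) :=
    (h.memLp_grad i).add (memLp_const t)
  have e : t ^ 2 * ∫ y in unitCell d, slabFun r j y =
      ∫ y in unitCell d, (2 * t * (g i y * slabFun r j y) + t ^ 2 * slabFun r j y) := by
    rw [integral_add (hi2.const_mul _) (hi1.const_mul _), integral_const_mul, integral_const_mul,
      h0]
    ring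
  rw [e]
  refine setIntegral_mono_on ((hi2.const_mul _).add (hi1.const_mul _))
    (hsq.integrable_sq.indicator hm) (measurableSet_unitCell d) fun y hy => ?_
  by_cases hyω : y ∈ closure ω
  · have : y ∈ Metric.closedBall (0 : Fin d → ℝ) r :=
      closure_minimal hω Metric.isClosed_closedBall hyω
    have hyj : |y j| ≤ r := (norm_le_pi_norm y j).trans (mem_closedBall_zero_iff.mp this)
    simp [slabFun_eq_zero hr hyj, hyω]
  · rw [Set.indicator_of_mem (show y ∈ unitCell d \ closure ω from ⟨hy, hyω⟩)]
    have f0 : 0 ≤ slabFun r j y := slabFun_nonneg r j y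
    have f1 : slabFun r j y ≤ 1 := slabFun_le_one r j y
    -- `(g + t - tφ)² ≥ 0` together with `φ² ≤ φ`.
    nlinarith [sq_nonneg (g i y + t - t * slabFun r j y),
      mul_nonneg (mul_nonneg f0 (sub_nonneg.mpr f1)) (sq_nonneg t)]

/-! ### Coefficient tensors and the contrast -/

/-- The bilinear form `T_{ik}^{αγ} F_k^γ H_i^α` of a coefficient tensor, on gradients
`F γ k = ∂_k u^γ` indexed as in the cell problem. -/
def fluxForm {d m : ℕ} (T : CoeffTensor d m) (F H : Fin m → Fin d → ℝ) : ℝ :=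
  ∑ i, ∑ k, ∑ α, ∑ γ, T i k α γ * F γ k * H α i

/-- The gradient of the affine map `y_j e^β`. -/
def unitGrad {d m : ℕ} (j : Fin d) (β : Fin m) (γ : Fin m) (k : Fin d) : ℝ :=
  if k = j ∧ γ = β then 1 else 0

theorem tensorForm_eq_fluxForm {d m : ℕ} (T : CoeffTensor d m) (ξ : Fin d → Fin m → ℝ) :
    tensorForm T ξ = fluxForm T (fun γ k => ξ k γ) (fun γ k => ξ k γ) := by
  simp only [tensorForm, fluxForm]
  refine Finset.sum_congr rfl fun i _ => Finset.sum_congr rfl fun j _ =>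
    Finset.sum_congr rfl fun α _ => Finset.sum_congr rfl fun β _ => ?_
  ring

theorem fluxForm_sum_left {d m : ℕ} {ι : Type*} [Fintype ι] (T : CoeffTensor d m) (c : ι → ℝ)
    (F : ι → Fin m → Fin d → ℝ) (H : Fin m → Fin d → ℝ) :
    fluxForm T (fun γ k => ∑ s, c s * F s γ k) H = ∑ s, c s * fluxForm T (F s) H := by
  simp only [fluxForm, Finset.mul_sum, Finset.sum_mul]
  symm
  rw [Finset.sum_comm]
  refine Finset.sum_congr rfl fun i _ => ?_
  rw [Finset.sum_comm]
  refine Finset.sum_congr rfl fun k _ => ?_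
  rw [Finset.sum_comm]
  refine Finset.sum_congr rfl fun α _ => ?_
  rw [Finset.sum_comm]
  refine Finset.sum_congr rfl fun γ _ => Finset.sum_congr rfl fun s _ => ?_
  ring

theorem fluxForm_sum_right {d m : ℕ} {ι : Type*} [Fintype ι] (T : CoeffTensor d m) (c : ι → ℝ)
    (F : Fin m → Fin d → ℝ) (H : ι → Fin m → Fin d → ℝ) :
    fluxForm T F (fun γ k => ∑ s, c s * H s γ k) = ∑ s, c s * fluxForm T F (H s) := by
  simp only [fluxForm, Finset.mul_sum]
  symm
  rw [Finset.sum_comm]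
  refine Finset.sum_congr rfl fun i _ => ?_
  rw [Finset.sum_comm]
  refine Finset.sum_congr rfl fun k _ => ?_
  rw [Finset.sum_comm]
  refine Finset.sum_congr rfl fun α _ => ?_
  rw [Finset.sum_comm]
  refine Finset.sum_congr rfl fun γ _ => Finset.sum_congr rfl fun s _ => ?_
  ring

theorem fluxForm_add_left {d m : ℕ} (T : CoeffTensor d m) (F F' H : Fin m → Fin d → ℝ) :
    fluxForm T (fun γ k => F γ k + F' γ k) H = fluxForm T F H + fluxForm T F' H := by
  simp only [fluxForm, mul_add, add_mul, Finset.sum_add_distrib]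

theorem fluxForm_add_right {d m : ℕ} (T : CoeffTensor d m) (F H H' : Fin m → Fin d → ℝ) :
    fluxForm T F (fun γ k => H γ k + H' γ k) = fluxForm T F H + fluxForm T F H' := by
  simp only [fluxForm, mul_add, Finset.sum_add_distrib]

theorem fluxForm_unitGrad_right {d m : ℕ} (T : CoeffTensor d m) (F : Fin m → Fin d → ℝ)
    (i : Fin d) (α : Fin m) :
    fluxForm T F (unitGrad i α) = ∑ k, ∑ γ, T i k α γ * F γ k := by
  simp only [fluxForm, unitGrad, ite_and, mul_ite, mul_one, mul_zero]
  rw [Finset.sum_eq_single i (fun b _ hb => by simp [hb]) (by simp)]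
  refine Finset.sum_congr rfl fun k _ => ?_
  rw [Finset.sum_eq_single α (fun b _ hb => by simp [hb]) (by simp)]
  simp

theorem fluxForm_unitGrad {d m : ℕ} (T : CoeffTensor d m) (i j : Fin d) (α β : Fin m) :
    fluxForm T (unitGrad j β) (unitGrad i α) = T i j α β := by
  rw [fluxForm_unitGrad_right, Finset.sum_eq_single j (fun b _ hb => by simp [unitGrad, hb])
    (by simp), Finset.sum_eq_single β (fun b _ hb => by simp [unitGrad, hb]) (by simp)]
  simp [unitGrad]

theorem sum_unitGrad_sq {d m : ℕ} (j : Fin d) (β : Fin m) :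
    ∑ k, ∑ γ, unitGrad j β γ k ^ 2 = 1 := by
  rw [Finset.sum_eq_single j (fun b _ hb => by simp [unitGrad, hb])
    (by simp), Finset.sum_eq_single β (fun b _ hb => by simp [unitGrad, hb]) (by simp)]
  simp [unitGrad]

/-- Ellipticity bounds the symmetric part of the coefficients, by polarization; the hypothesis on
the skew part bounds the rest. -/
theorem abs_coeff_le {d m : ℕ} {μ M : ℝ} (hμ : 0 < μ) {A : (Fin d → ℝ) → CoeffTensor d m}
    (hA : IsStronglyElliptic μ A) (hS : HasSkewBound M A) (y : Fin d → ℝ) (i j : Fin d)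
    (α β : Fin m) : |A y i j α β| ≤ 2 * μ⁻¹ + M := by
  have hμ' : 0 < μ⁻¹ := inv_pos.mpr hμ
  -- Test the ellipticity condition with `ξ = e_i^α + s e_j^β` for `s = ±1`.
  have hpol : ∀ s : ℝ, s ^ 2 = 1 →
      0 ≤ A y i i α α + A y j j β β + s * (A y i j α β + A y j i β α) ∧
      A y i i α α + A y j j β β + s * (A y i j α β + A y j i β α) ≤ 4 * μ⁻¹ := by
    intro s hs
    have hform : tensorForm (A y) (fun k γ => unitGrad i α γ k + s * unitGrad j β γ k) =
        A y i i α α + A y j j β β + s * (A y i j α β + A y j i β α) := by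
      have h2 : ∀ (F : Fin m → Fin d → ℝ),
          fluxForm (A y) (fun γ k => s * unitGrad j β γ k) F =
          s * fluxForm (A y) (unitGrad j β) F := fun F => by
        have := fluxForm_sum_left (ι := Unit) (A y) (fun _ => s) (fun _ => unitGrad j β) F
        simpa using this
      have h3 : ∀ (F : Fin m → Fin d → ℝ),
          fluxForm (A y) F (fun γ k => s * unitGrad j β γ k) =
          s * fluxForm (A y) F (unitGrad j β) := fun F => by
        have := fluxForm_sum_right (ι := Unit) (A y) (fun _ => s) F (fun _ => unitGrad j β)
        simpa using this
      have h4 : fluxForm (A y) (unitGrad i α) (fun γ k => unitGrad i α γ k) = A y i i α α :=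
        fluxForm_unitGrad _ _ _ _ _
      rw [tensorForm_eq_fluxForm, fluxForm_add_left, fluxForm_add_right, fluxForm_add_right]
      simp only [h2, h3]
      rw [fluxForm_unitGrad, fluxForm_unitGrad, fluxForm_unitGrad, fluxForm_unitGrad]
      linear_combination A y j j β β * hs
    have hnorm0 : 0 ≤ normSqVec (fun k γ => unitGrad i α γ k + s * unitGrad j β γ k) := by
      unfold normSqVec; positivity
    have hnorm : normSqVec (fun k γ => unitGrad i α γ k + s * unitGrad j β γ k) ≤ 4 := by
      have h1 : (4 : ℝ) = ∑ k, ∑ γ, (2 * unitGrad i α γ k ^ 2 + 2 * unitGrad j β γ k ^ 2) := by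
        simp only [Finset.sum_add_distrib, ← Finset.mul_sum, sum_unitGrad_sq]
        norm_num
      rw [h1]
      refine Finset.sum_le_sum fun k _ => Finset.sum_le_sum fun γ _ => ?_
      nlinarith [sq_nonneg (unitGrad i α γ k - s * unitGrad j β γ k)]
    obtain ⟨h1, h2⟩ := hA y (fun k γ => unitGrad i α γ k + s * unitGrad j β γ k)
    rw [hform] at h1 h2
    constructor
    · exact (mul_nonneg hμ.le hnorm0).trans h1
    · refine h2.trans ?_
      nlinarith
  obtain ⟨h1, h2⟩ := hpol 1 (by norm_num)
  obtain ⟨h3, h4⟩ := hpol (-1) (by norm_num)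
  have h5 := abs_le.mp (hS y i j α β)
  have h6 : 0 ≤ M := (abs_nonneg _).trans (hS y i j α β)
  rw [abs_le]
  constructor <;> linarith

theorem measurable_contrast {d : ℕ} {ω : Set (Fin d → ℝ)} (hω : IsOpen ω) (δ : ℝ) :
    Measurable (contrast ω δ) := by
  have h1 := hω.measurableSet
  have h2 := (measurableSet_unitCell d).diff (isClosed_closure (s := ω)).measurableSet
  exact ((measurable_const.indicator h1).const_mul δ).add (measurable_const.indicator h2)

theorem contrast_of_mem {d : ℕ} {ω : Set (Fin d → ℝ)} {δ : ℝ} {y : Fin d → ℝ} (hy : y ∈ ω) :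
    contrast ω δ y = δ := by
  simp [contrast, hy, subset_closure hy]

theorem contrast_of_notMem {d : ℕ} {ω : Set (Fin d → ℝ)} {δ : ℝ} {y : Fin d → ℝ} (hy : y ∉ ω) :
    contrast ω δ y = (unitCell d \ closure ω).indicator (fun _ => (1 : ℝ)) y := by
  simp [contrast, hy]

theorem contrast_of_mem_diff {d : ℕ} {ω : Set (Fin d → ℝ)} {δ : ℝ} {y : Fin d → ℝ}
    (hy : y ∈ unitCell d \ closure ω) : contrast ω δ y = 1 := by
  rw [contrast_of_notMem fun h => hy.2 (subset_closure h), Set.indicator_of_mem hy]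

theorem contrast_nonneg {d : ℕ} (ω : Set (Fin d → ℝ)) {δ : ℝ} (hδ : 0 < δ) (y : Fin d → ℝ) :
    0 ≤ contrast ω δ y := by
  unfold contrast
  exact add_nonneg (mul_nonneg hδ.le (Set.indicator_nonneg (fun _ _ => zero_le_one) _))
    (Set.indicator_nonneg (fun _ _ => zero_le_one) _)

theorem contrast_le {d : ℕ} (ω : Set (Fin d → ℝ)) {δ : ℝ} (hδ : 0 < δ) (y : Fin d → ℝ) :
    contrast ω δ y ≤ δ + 1 := by
  by_cases hy : y ∈ ω
  · rw [contrast_of_mem hy]; linarith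
  · rw [contrast_of_notMem hy]
    refine (Set.indicator_le_self' (fun _ _ => zero_le_one) y).trans ?_
    linarith

/-- The contrast is bounded below almost everywhere: it vanishes in the cell only on the boundary
of the inclusion. -/
theorem min_le_contrast {d : ℕ} {ω : Set (Fin d → ℝ)} (hω : IsInclusion ω) (δ : ℝ) :
    ∀ᵐ y ∂volume.restrict (unitCell d), min δ 1 ≤ contrast ω δ y := by
  have h0 : ∀ᵐ y : Fin d → ℝ, y ∉ frontier ω :=
    measure_eq_zero_iff_ae_notMem.mp hω.lipschitz.volume_frontier_eq_zero
  filter_upwards [ae_restrict_of_ae h0, ae_restrict_mem (measurableSet_unitCell d)] with y hy hyY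
  by_cases hyω : y ∈ ω
  · rw [contrast_of_mem hyω]; exact min_le_left _ _
  · rw [contrast_of_mem_diff ⟨hyY, fun hc => hy ⟨hc, ?_⟩⟩]
    · exact min_le_right _ _
    · rwa [hω.isOpen.interior_eq]

/-- The bilinear form `∫_Y Λ_δ A F · H` of the cell problem, on vector fields `F`, `H`. -/
noncomputable def energyForm {d m : ℕ} (A : (Fin d → ℝ) → CoeffTensor d m)
    (ω : Set (Fin d → ℝ)) (δ : ℝ) (F H : Fin m → Fin d → (Fin d → ℝ) → ℝ) : ℝ :=
  ∫ y in unitCell d, contrast ω δ y * fluxForm (A y) (fun γ k => F γ k y) (fun γ k => H γ k y)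

theorem memLp_contrast_coeff {d m : ℕ} {μ M : ℝ} (hμ : 0 < μ) {A : (Fin d → ℝ) → CoeffTensor d m}
    (hAm : Measurable A) (hA : IsStronglyElliptic μ A) (hS : HasSkewBound M A)
    {ω : Set (Fin d → ℝ)} (hω : IsOpen ω) {δ : ℝ} (hδ : 0 < δ) (i k : Fin d) (α γ : Fin m) :
    MemLp (fun y => contrast ω δ y * A y i k α γ) ⊤ (volume.restrict (unitCell d)) := by
  have hm : Measurable fun y => A y i k α γ :=
    (measurable_pi_apply γ).comp ((measurable_pi_apply α).comp
      ((measurable_pi_apply k).comp ((measurable_pi_apply i).comp hAm)))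
  refine memLp_top_of_bound ((measurable_contrast hω δ).mul hm).aestronglyMeasurable
    ((δ + 1) * (2 * μ⁻¹ + M)) (Filter.Eventually.of_forall fun y => ?_)
  rw [norm_mul, Real.norm_of_nonneg (contrast_nonneg ω hδ y)]
  exact mul_le_mul (contrast_le ω hδ y) (abs_coeff_le hμ hA hS y i k α γ) (norm_nonneg _)
    (by linarith)

theorem integrable_energyForm {d m : ℕ} {A : (Fin d → ℝ) → CoeffTensor d m}
    {ω : Set (Fin d → ℝ)} {δ : ℝ}
    (hc : ∀ i k α γ, MemLp (fun y => contrast ω δ y * A y i k α γ) ⊤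
      (volume.restrict (unitCell d)))
    {F H : Fin m → Fin d → (Fin d → ℝ) → ℝ}
    (hF : ∀ γ k, MemLp (F γ k) 2 (volume.restrict (unitCell d)))
    (hH : ∀ γ k, MemLp (H γ k) 2 (volume.restrict (unitCell d))) :
    Integrable (fun y => contrast ω δ y *
      fluxForm (A y) (fun γ k => F γ k y) (fun γ k => H γ k y))
      (volume.restrict (unitCell d)) := by
  simp only [fluxForm, Finset.mul_sum]
  refine integrable_finsetSum _ fun i _ => integrable_finsetSum _ fun k _ =>
    integrable_finsetSum _ fun α _ => integrable_finsetSum _ fun γ _ => ?_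
  have h1 : MemLp (fun y => (contrast ω δ y * A y i k α γ) * F γ k y) 2
    (volume.restrict (unitCell d)) := (hF γ k).mul (hc i k α γ)
  refine (h1.integrable_mul (hH α i)).congr (Filter.Eventually.of_forall fun y => ?_)
  simp only [Pi.mul_apply]
  ring

/-! ### The Hilbert space of periodic functions -/

/-- The integral of a partial derivative of a smooth periodic function over the cell vanishes:
constants are weakly differentiable on the torus, with zero gradient. -/
theorem isTorusH1_const {d : ℕ} (c : ℝ) : IsTorusH1 (fun _ : Fin d → ℝ => c) (fun _ _ => 0) := by
  refine ⟨memLp_const c, fun _ => memLp_const 0, fun φ hφ hper i => ?_⟩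
  obtain ⟨n, rfl⟩ : ∃ n, d = n + 1 := ⟨d - 1, by have := i.pos; omega⟩
  have hcell : volume.restrict (unitCell (n + 1)) =
      volume.restrict (Set.Icc (fun _ : Fin (n + 1) => -(1 / 2 : ℝ)) fun _ => 1 / 2) := by
    apply Measure.restrict_congr_set
    rw [unitCell_eq_pi]
    exact Measure.univ_pi_Ioo_ae_eq_Icc (μ := fun _ : Fin (n + 1) => (volume : Measure ℝ))
  have hφd : Continuous fun y => fderiv ℝ φ y (Pi.single i 1) :=
    (hφ.continuous_fderiv (by simp)).clm_apply continuous_const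
  have hsum : ∀ y, ∑ j, ((if j = i then fderiv ℝ φ y else 0 : (Fin (n + 1) → ℝ) →L[ℝ] ℝ)
      (Pi.single j 1)) = fderiv ℝ φ y (Pi.single i 1) := by
    intro y
    rw [Finset.sum_eq_single i (fun b _ hb => by simp [hb]) (by simp)]
    simp
  -- Divergence theorem for `φ e_i`: opposite faces cancel by periodicity.
  have key := integral_divergence_of_hasFDerivAt_off_countable
    (fun _ : Fin (n + 1) => -(1 / 2 : ℝ)) (fun _ => 1 / 2) (fun _ => by norm_num)
    (fun y j => if j = i then φ y else 0)
    (fun y => ContinuousLinearMap.pi fun j => if j = i then fderiv ℝ φ y else 0) ∅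
    Set.countable_empty ?_ ?_ ?_
  · simp only [ContinuousLinearMap.pi_apply, hsum] at key
    rw [integral_const_mul, hcell, key, Finset.sum_eq_zero, mul_zero]
    · simp
    · intro j _
      by_cases hj : j = i
      · subst hj
        simp only [if_true]
        rw [sub_eq_zero]
        congr 1 with x
        have := hper (j.insertNth (-(1 / 2 : ℝ)) x) (Pi.single j 1)
        rw [← this]
        congr 1
        ext l
        refine Fin.succAboveCases j ?_ (fun l => ?_) l
        · norm_num
        · simp
      · simp [hj]
  · refine continuousOn_pi.mpr fun j => ?_
    by_cases hj : j = i
    · simpa [hj] using hφ.continuous.continuousOn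
    · simpa [hj] using continuousOn_const
  · intro y _
    refine hasFDerivAt_pi.mpr fun j => ?_
    by_cases hj : j = i
    · simpa [hj] using ((hφ.differentiable (by simp)) y).hasFDerivAt
    · simpa [hj] using hasFDerivAt_const (0 : ℝ) y
  · simp only [ContinuousLinearMap.pi_apply, hsum]
    exact hφd.continuousOn.integrableOn_compact isCompact_Icc

theorem IsTorusH1.add {d : ℕ} {u v : (Fin d → ℝ) → ℝ} {g h : Fin d → (Fin d → ℝ) → ℝ}
    (hu : IsTorusH1 u g) (hv : IsTorusH1 v h) :
    IsTorusH1 (fun y => u y + v y) (fun i y => g i y + h i y) := by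
  refine ⟨hu.memLp.add hv.memLp, fun i => (hu.memLp_grad i).add (hv.memLp_grad i),
    fun φ hφ hper i => ?_⟩
  have hφd : Continuous fun y => fderiv ℝ φ y (Pi.single i 1) :=
    (hφ.continuous_fderiv (by simp)).clm_apply continuous_const
  simp only [add_mul]
  rw [integral_add (integrableOn_mul_continuous hu.memLp hφd)
    (integrableOn_mul_continuous hv.memLp hφd),
    integral_add (integrableOn_mul_continuous (hu.memLp_grad i) hφ.continuous)
    (integrableOn_mul_continuous (hv.memLp_grad i) hφ.continuous),
    hu.integral_by_parts φ hφ hper i, hv.integral_by_parts φ hφ hper i]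
  ring

theorem IsTorusH1.const_mul {d : ℕ} {u : (Fin d → ℝ) → ℝ} {g : Fin d → (Fin d → ℝ) → ℝ}
    (hu : IsTorusH1 u g) (c : ℝ) : IsTorusH1 (fun y => c * u y) (fun i y => c * g i y) := by
  refine ⟨hu.memLp.const_mul c, fun i => (hu.memLp_grad i).const_mul c, fun φ hφ hper i => ?_⟩
  simp only [mul_assoc, integral_const_mul, hu.integral_by_parts φ hφ hper i, mul_neg]

theorem IsTorusH1.sum {d : ℕ} {ι : Type*} [Fintype ι] {u : ι → (Fin d → ℝ) → ℝ}
    {g : ι → Fin d → (Fin d → ℝ) → ℝ} (h : ∀ s, IsTorusH1 (u s) (g s)) (c : ι → ℝ) :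
    IsTorusH1 (fun y => ∑ s, c s * u s y) (fun i y => ∑ s, c s * g s i y) := by
  have : ∀ S : Finset ι, IsTorusH1 (fun y => ∑ s ∈ S, c s * u s y)
      (fun i y => ∑ s ∈ S, c s * g s i y) := by
    classical
    intro S
    induction S using Finset.induction_on with
    | empty => simpa using isTorusH1_const 0
    | insert s S hs ih =>
      simp only [Finset.sum_insert hs]
      exact ((h s).const_mul (c s)).add ih
  exact this _

theorem IsTorusH1.sub_const {d : ℕ} {u : (Fin d → ℝ) → ℝ} {g : Fin d → (Fin d → ℝ) → ℝ}
    (h : IsTorusH1 u g) (c : ℝ) : IsTorusH1 (fun y => u y - c) g := by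
  simpa [sub_eq_add_neg] using h.add (isTorusH1_const (-c))

theorem IsTorusH1.congr_ae {d : ℕ} {u v : (Fin d → ℝ) → ℝ} {g h : Fin d → (Fin d → ℝ) → ℝ}
    (hu : IsTorusH1 u g) (huv : u =ᵐ[volume.restrict (unitCell d)] v)
    (hgh : ∀ i, g i =ᵐ[volume.restrict (unitCell d)] h i) : IsTorusH1 v h := by
  refine ⟨hu.memLp.ae_eq huv, fun i => (hu.memLp_grad i).ae_eq (hgh i), fun φ hφ hper i => ?_⟩
  have e1 : ∫ y in unitCell d, v y * fderiv ℝ φ y (Pi.single i 1) =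
      ∫ y in unitCell d, u y * fderiv ℝ φ y (Pi.single i 1) := by
    refine integral_congr_ae ?_
    filter_upwards [huv] with y hy
    rw [hy]
  have e2 : ∫ y in unitCell d, h i y * φ y = ∫ y in unitCell d, g i y * φ y := by
    refine integral_congr_ae ?_
    filter_upwards [hgh i] with y hy
    rw [hy]
  rw [e1, e2, hu.integral_by_parts φ hφ hper i]

/-- The square integrable functions on the cell. -/
abbrev CellL2 (d : ℕ) : Type := Lp ℝ 2 (volume.restrict (unitCell d))

/-- Candidates for a function (slot `none`) together with its gradient (slots `some k`), for each of
the `m` components. -/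
abbrev CellPair (d m : ℕ) : Type := PiLp 2 fun _ : Fin m × Option (Fin d) => CellL2 d

/-- Mean-zero `H¹(𝕋^d; ℝ^m)` functions, as a subspace of the space of square integrable pairs of a
function and a gradient. -/
def torusH1 (d m : ℕ) : Submodule ℝ (CellPair d m) where
  carrier := {f | ∀ γ, IsTorusH1 (f (γ, none)) (fun k => f (γ, some k)) ∧
    ∫ y in unitCell d, f (γ, none) y = 0}
  add_mem' := by
    intro f g hf hg γ
    refine ⟨((hf γ).1.add (hg γ).1).congr_ae (Lp.coeFn_add _ _).symm
      fun i => (Lp.coeFn_add _ _).symm, ?_⟩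
    refine (integral_congr_ae (Lp.coeFn_add (f (γ, none)) (g (γ, none)))).trans ?_
    rw [integral_add' ((Lp.memLp _).integrable (by norm_num))
      ((Lp.memLp _).integrable (by norm_num)), (hf γ).2, (hg γ).2, add_zero]
  zero_mem' := by
    intro γ
    refine ⟨(isTorusH1_const 0).congr_ae (Lp.coeFn_zero _ _ _).symm
      fun i => (Lp.coeFn_zero _ _ _).symm, ?_⟩
    refine (integral_congr_ae (Lp.coeFn_zero _ _ _)).trans ?_
    simp
  smul_mem' := by
    intro c f hf γ
    refine ⟨((hf γ).1.const_mul c).congr_ae (Lp.coeFn_smul c (f (γ, none))).symm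
      fun i => (Lp.coeFn_smul c (f (γ, some i))).symm, ?_⟩
    refine (integral_congr_ae (Lp.coeFn_smul c (f (γ, none)))).trans ?_
    simp [integral_const_mul, (hf γ).2]

theorem inner_toLp_eq {d : ℕ} {v : (Fin d → ℝ) → ℝ}
    (hv : MemLp v 2 (volume.restrict (unitCell d))) (f : CellL2 d) :
    inner ℝ hv.toLp f = ∫ y in unitCell d, f y * v y := by
  rw [L2.inner_def]
  refine integral_congr_ae ?_
  filter_upwards [hv.coeFn_toLp] with y hy
  rw [hy]
  simp

theorem continuous_integral_mul {d m : ℕ} {v : (Fin d → ℝ) → ℝ} (hv : Continuous v)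
    (s : Fin m × Option (Fin d)) :
    Continuous fun f : CellPair d m => ∫ y in unitCell d, f s y * v y := by
  simp only [← inner_toLp_eq (memLp_unitCell_of_continuous hv)]
  exact continuous_const.inner (PiLp.continuous_apply 2 _ s)

/-- Weak differentiability is tested by continuous functionals, so it passes to limits. -/
theorem isClosed_torusH1 (d m : ℕ) : IsClosed (torusH1 d m : Set (CellPair d m)) := by
  have e : (torusH1 d m : Set (CellPair d m)) = {f | ∀ γ,
      (∀ φ : (Fin d → ℝ) → ℝ, ContDiff ℝ ((⊤ : ℕ∞) : WithTop ℕ∞) φ → IsLatticePeriodic φ →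
        ∀ i, ∫ y in unitCell d, f (γ, none) y * fderiv ℝ φ y (Pi.single i 1)
          = -∫ y in unitCell d, f (γ, some i) y * φ y) ∧
      ∫ y in unitCell d, f (γ, none) y * 1 = 0} := by
    ext f
    simp only [mul_one]
    exact forall_congr' fun γ => and_congr_left fun _ =>
      ⟨fun h => h.integral_by_parts, fun h => ⟨Lp.memLp _, fun _ => Lp.memLp _, h⟩⟩
  rw [e]
  simp only [Set.ofPred_forall, Set.ofPred_and]
  refine isClosed_iInter fun γ => IsClosed.inter ?_ ?_
  · refine isClosed_iInter fun φ => isClosed_iInter fun hφ => isClosed_iInter fun _ =>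
      isClosed_iInter fun i => ?_
    exact isClosed_eq (continuous_integral_mul
      ((hφ.continuous_fderiv (by simp)).clm_apply continuous_const) _)
      (continuous_integral_mul hφ.continuous _).neg
  · exact isClosed_eq (continuous_integral_mul continuous_const _) continuous_const

/-! ### Coercivity and solvability of the cell problem -/

/-- Multiplication by a bounded coefficient, as a bilinear form on square integrable functions. -/
noncomputable def coeffPairing {d : ℕ} {c : (Fin d → ℝ) → ℝ}
    (hc : MemLp c ⊤ (volume.restrict (unitCell d))) : CellL2 d →L[ℝ] CellL2 d →L[ℝ] ℝ :=
  (innerSL ℝ).comp ((ContinuousLinearMap.mul ℝ ℝ).holderL (volume.restrict (unitCell d)) ⊤ 2 2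
    hc.toLp)

theorem coeffPairing_apply {d : ℕ} {c : (Fin d → ℝ) → ℝ}
    (hc : MemLp c ⊤ (volume.restrict (unitCell d))) (f g : CellL2 d) :
    coeffPairing hc f g = ∫ y in unitCell d, c y * f y * g y := by
  simp only [coeffPairing, ContinuousLinearMap.comp_apply, innerSL_apply_apply]
  rw [L2.inner_def]
  refine integral_congr_ae ?_
  filter_upwards [hc.coeFn_toLp, ContinuousLinearMap.coeFn_holder (r := 2)
    (ContinuousLinearMap.mul ℝ ℝ) hc.toLp f] with y h1 h2
  have : (((ContinuousLinearMap.mul ℝ ℝ).holderL (volume.restrict (unitCell d)) ⊤ 2 2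
    hc.toLp) f : CellL2 d) y = c y * f y := by
    refine h2.trans ?_
    rw [h1]; rfl
  rw [this]
  simp [mul_comm]

/-- The bilinear form of the cell problem on square integrable pairs. -/
noncomputable def cellForm {d m : ℕ} {A : (Fin d → ℝ) → CoeffTensor d m}
    {ω : Set (Fin d → ℝ)} {δ : ℝ}
    (hc : ∀ i k α γ, MemLp (fun y => contrast ω δ y * A y i k α γ) ⊤
      (volume.restrict (unitCell d))) : CellPair d m →L[ℝ] CellPair d m →L[ℝ] ℝ :=
  ∑ i, ∑ k, ∑ α, ∑ γ, (coeffPairing (hc i k α γ)).bilinearComp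
    (PiLp.proj 2 (fun _ : Fin m × Option (Fin d) => CellL2 d) (γ, some k))
    (PiLp.proj 2 (fun _ : Fin m × Option (Fin d) => CellL2 d) (α, some i))

theorem cellForm_apply {d m : ℕ} {A : (Fin d → ℝ) → CoeffTensor d m}
    {ω : Set (Fin d → ℝ)} {δ : ℝ}
    (hc : ∀ i k α γ, MemLp (fun y => contrast ω δ y * A y i k α γ) ⊤
      (volume.restrict (unitCell d))) (f g : CellPair d m) :
    cellForm hc f g = energyForm A ω δ (fun γ k => f (γ, some k)) (fun γ k => g (γ, some k)) := by
  have hi : ∀ i k α γ, Integrable (fun y => contrast ω δ y *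
      (A y i k α γ * f (γ, some k) y * g (α, some i) y)) (volume.restrict (unitCell d)) := by
    intro i k α γ
    have h1 : MemLp (fun y => (contrast ω δ y * A y i k α γ) * f (γ, some k) y) 2
      (volume.restrict (unitCell d)) := (Lp.memLp (f (γ, some k))).mul (hc i k α γ)
    refine (h1.integrable_mul (Lp.memLp (g (α, some i)))).congr
      (Filter.Eventually.of_forall fun y => ?_)
    simp only [Pi.mul_apply]
    ring
  simp only [energyForm, fluxForm, Finset.mul_sum]
  rw [integral_finsetSum _ fun i _ => integrable_finsetSum _ fun k _ =>
    integrable_finsetSum _ fun α _ => integrable_finsetSum _ fun γ _ => hi i k α γ]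
  simp only [cellForm, sum_apply, ContinuousLinearMap.bilinearComp_apply]
  refine Finset.sum_congr rfl fun i _ => ?_
  rw [integral_finsetSum _ fun k _ =>
    integrable_finsetSum _ fun α _ => integrable_finsetSum _ fun γ _ => hi i k α γ]
  refine Finset.sum_congr rfl fun k _ => ?_
  rw [integral_finsetSum _ fun α _ => integrable_finsetSum _ fun γ _ => hi i k α γ]
  refine Finset.sum_congr rfl fun α _ => ?_
  rw [integral_finsetSum _ fun γ _ => hi i k α γ]
  refine Finset.sum_congr rfl fun γ _ => ?_
  rw [coeffPairing_apply]
  refine integral_congr_ae (Filter.Eventually.of_forall fun y => ?_)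
  simp only [PiLp.proj_apply]
  ring

theorem norm_sq_cellL2 {d : ℕ} (f : CellL2 d) : ‖f‖ ^ 2 = ∫ y in unitCell d, f y ^ 2 := by
  rw [← real_inner_self_eq_norm_sq, L2.inner_def]
  refine integral_congr_ae (Filter.Eventually.of_forall fun y => ?_)
  simp [pow_two]

/-- Coercivity of the cell form: ellipticity controls the gradient, and the Poincaré inequality
controls the function. -/
theorem cellForm_coercive {d m : ℕ} {μ : ℝ} (hμ : 0 < μ) {A : (Fin d → ℝ) → CoeffTensor d m}
    (hA : IsStronglyElliptic μ A) {ω : Set (Fin d → ℝ)} (hω : IsInclusion ω) {δ : ℝ} (hδ : 0 < δ)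
    (hc : ∀ i k α γ, MemLp (fun y => contrast ω δ y * A y i k α γ) ⊤
      (volume.restrict (unitCell d))) (f : CellPair d m) (hf : f ∈ torusH1 d m) :
    min δ 1 * μ / 2 * ‖f‖ * ‖f‖ ≤ cellForm hc f f := by
  have hmin : 0 < min δ 1 := lt_min hδ one_pos
  have hgrad : min δ 1 * μ * ∑ γ, ∑ k, ‖f (γ, some k)‖ ^ 2 ≤ cellForm hc f f := by
    rw [cellForm_apply, energyForm]
    have hint : ∀ γ k, Integrable (fun y => f (γ, some k) y ^ 2) (volume.restrict (unitCell d)) :=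
      fun γ k => (Lp.memLp (f (γ, some k))).integrable_sq
    have e : min δ 1 * μ * ∑ γ, ∑ k, ‖f (γ, some k)‖ ^ 2 =
        ∫ y in unitCell d, min δ 1 * μ * ∑ γ, ∑ k, f (γ, some k) y ^ 2 := by
      rw [integral_const_mul, integral_finsetSum _ fun γ _ => integrable_finsetSum _ fun k _ =>
        hint γ k]
      congr 1
      refine Finset.sum_congr rfl fun γ _ => ?_
      rw [integral_finsetSum _ fun k _ => hint γ k]
      exact Finset.sum_congr rfl fun k _ => norm_sq_cellL2 _
    rw [e]
    refine integral_mono_ae ?_ (integrable_energyForm hc (fun _ _ => Lp.memLp _)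
      (fun _ _ => Lp.memLp _)) ?_
    · exact (integrable_finsetSum _ fun γ _ => integrable_finsetSum _ fun k _ =>
        hint γ k).const_mul _
    filter_upwards [min_le_contrast hω δ] with y hy
    have h1 := (hA y fun k γ => f (γ, some k) y).1
    rw [tensorForm_eq_fluxForm, normSqVec, Finset.sum_comm] at h1
    have h2 : 0 ≤ μ * ∑ γ, ∑ k, f (γ, some k) y ^ 2 := by positivity
    rw [mul_assoc]
    exact mul_le_mul hy h1 h2 (hmin.le.trans hy)
  have hnorm : ‖f‖ * ‖f‖ ≤ 2 * ∑ γ, ∑ k, ‖f (γ, some k)‖ ^ 2 := by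
    rw [← pow_two, PiLp.norm_sq_eq_of_L2, Fintype.sum_prod_type, Finset.mul_sum]
    refine Finset.sum_le_sum fun γ _ => ?_
    rw [Fintype.sum_option]
    have := (hf γ).1.poincare (hf γ).2
    simp only [← norm_sq_cellL2] at this
    linarith
  calc min δ 1 * μ / 2 * ‖f‖ * ‖f‖ = min δ 1 * μ / 2 * (‖f‖ * ‖f‖) := by ring
    _ ≤ min δ 1 * μ / 2 * (2 * ∑ γ, ∑ k, ‖f (γ, some k)‖ ^ 2) := by gcongr
    _ = min δ 1 * μ * ∑ γ, ∑ k, ‖f (γ, some k)‖ ^ 2 := by ring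
    _ ≤ _ := hgrad

theorem energyForm_congr_ae {d m : ℕ} {A : (Fin d → ℝ) → CoeffTensor d m}
    {ω : Set (Fin d → ℝ)} {δ : ℝ} {F F' H H' : Fin m → Fin d → (Fin d → ℝ) → ℝ}
    (hF : ∀ γ k, F γ k =ᵐ[volume.restrict (unitCell d)] F' γ k)
    (hH : ∀ γ k, H γ k =ᵐ[volume.restrict (unitCell d)] H' γ k) :
    energyForm A ω δ F H = energyForm A ω δ F' H' := by
  refine integral_congr_ae ?_
  filter_upwards [ae_all_iff.mpr fun γ => ae_all_iff.mpr fun k => hF γ k,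
    ae_all_iff.mpr fun γ => ae_all_iff.mpr fun k => hH γ k] with y h1 h2
  simp only [h1, h2]

theorem energyForm_add_right {d m : ℕ} {A : (Fin d → ℝ) → CoeffTensor d m}
    {ω : Set (Fin d → ℝ)} {δ : ℝ}
    (hc : ∀ i k α γ, MemLp (fun y => contrast ω δ y * A y i k α γ) ⊤
      (volume.restrict (unitCell d)))
    {F H H' : Fin m → Fin d → (Fin d → ℝ) → ℝ}
    (hF : ∀ γ k, MemLp (F γ k) 2 (volume.restrict (unitCell d)))
    (hH : ∀ γ k, MemLp (H γ k) 2 (volume.restrict (unitCell d)))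
    (hH' : ∀ γ k, MemLp (H' γ k) 2 (volume.restrict (unitCell d))) :
    energyForm A ω δ F (fun γ k y => H γ k y + H' γ k y) =
      energyForm A ω δ F H + energyForm A ω δ F H' := by
  simp only [energyForm, fluxForm_add_right, mul_add]
  exact integral_add (integrable_energyForm hc hF hH) (integrable_energyForm hc hF hH')

theorem energyForm_sum_left {d m : ℕ} {ι : Type*} [Fintype ι] {A : (Fin d → ℝ) → CoeffTensor d m}
    {ω : Set (Fin d → ℝ)} {δ : ℝ}
    (hc : ∀ i k α γ, MemLp (fun y => contrast ω δ y * A y i k α γ) ⊤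
      (volume.restrict (unitCell d)))
    {F : ι → Fin m → Fin d → (Fin d → ℝ) → ℝ} {H : Fin m → Fin d → (Fin d → ℝ) → ℝ}
    (hF : ∀ s γ k, MemLp (F s γ k) 2 (volume.restrict (unitCell d)))
    (hH : ∀ γ k, MemLp (H γ k) 2 (volume.restrict (unitCell d))) (c : ι → ℝ) :
    energyForm A ω δ (fun γ k y => ∑ s, c s * F s γ k y) H =
      ∑ s, c s * energyForm A ω δ (F s) H := by
  have e : ∀ y, fluxForm (A y) (fun γ k => ∑ s, c s * F s γ k y) (fun γ k => H γ k y) =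
      ∑ s, c s * fluxForm (A y) (fun γ k => F s γ k y) (fun γ k => H γ k y) := fun y =>
    fluxForm_sum_left (A y) c (fun s γ k => F s γ k y) _
  simp only [energyForm, e, Finset.mul_sum, mul_left_comm _ (c _)]
  rw [integral_finsetSum _ fun s _ => (integrable_energyForm hc (hF s) hH).const_mul (c s)]
  simp only [integral_const_mul]

theorem energyForm_sum_right {d m : ℕ} {ι : Type*} [Fintype ι] {A : (Fin d → ℝ) → CoeffTensor d m}
    {ω : Set (Fin d → ℝ)} {δ : ℝ}
    (hc : ∀ i k α γ, MemLp (fun y => contrast ω δ y * A y i k α γ) ⊤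
      (volume.restrict (unitCell d)))
    {F : Fin m → Fin d → (Fin d → ℝ) → ℝ} {H : ι → Fin m → Fin d → (Fin d → ℝ) → ℝ}
    (hF : ∀ γ k, MemLp (F γ k) 2 (volume.restrict (unitCell d)))
    (hH : ∀ s γ k, MemLp (H s γ k) 2 (volume.restrict (unitCell d))) (c : ι → ℝ) :
    energyForm A ω δ F (fun γ k y => ∑ s, c s * H s γ k y) =
      ∑ s, c s * energyForm A ω δ F (H s) := by
  have e : ∀ y, fluxForm (A y) (fun γ k => F γ k y) (fun γ k => ∑ s, c s * H s γ k y) =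
      ∑ s, c s * fluxForm (A y) (fun γ k => F γ k y) (fun γ k => H s γ k y) := fun y =>
    fluxForm_sum_right (A y) c _ (fun s γ k => H s γ k y)
  simp only [energyForm, e, Finset.mul_sum, mul_left_comm _ (c _)]
  rw [integral_finsetSum _ fun s _ => (integrable_energyForm hc hF (hH s)).const_mul (c s)]
  simp only [integral_const_mul]

/-- The constant gradient of `y_j e^β`, as a candidate pair. The function slot holds `0`, since the
cell form does not see it and `y_j e^β` is not periodic anyway. -/
noncomputable def affinePair {d m : ℕ} (j : Fin d) (β : Fin m) : CellPair d m :=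
  WithLp.toLp 2 fun s => s.2.elim 0 fun k =>
    (memLp_const (unitGrad j β s.1 k) : MemLp (fun _ => unitGrad j β s.1 k) 2
      (volume.restrict (unitCell d))).toLp

/-- The cell problem is solvable, by the Lax–Milgram theorem. -/
theorem exists_isCellSolution {d m : ℕ} {μ : ℝ} (hμ : 0 < μ) {A : (Fin d → ℝ) → CoeffTensor d m}
    (hA : IsStronglyElliptic μ A) {ω : Set (Fin d → ℝ)} (hω : IsInclusion ω) {δ : ℝ} (hδ : 0 < δ)
    (hc : ∀ i k α γ, MemLp (fun y => contrast ω δ y * A y i k α γ) ⊤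
      (volume.restrict (unitCell d))) (j : Fin d) (β : Fin m) :
    ∃ χ G, IsCellSolution A ω δ j β χ G := by
  have : CompleteSpace (torusH1 d m) := (isClosed_torusH1 d m).completeSpace_coe
  let B : torusH1 d m →L[ℝ] torusH1 d m →L[ℝ] ℝ :=
    (cellForm hc).bilinearComp (torusH1 d m).subtypeL (torusH1 d m).subtypeL
  have hB : IsCoercive B := ⟨min δ 1 * μ / 2,
    by have := lt_min hδ one_pos; positivity, fun f => cellForm_coercive hμ hA hω hδ hc f f.2⟩
  let ℓ : StrongDual ℝ (torusH1 d m) := -(cellForm hc (affinePair j β)).comp (torusH1 d m).subtypeL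
  let f : torusH1 d m := hB.continuousLinearEquivOfBilin.symm
    ((InnerProductSpace.toDual ℝ (torusH1 d m)).symm ℓ)
  have hf : ∀ v ∈ torusH1 d m, cellForm hc (f.1 + affinePair j β) v = 0 := by
    intro v hv
    have h1 := hB.continuousLinearEquivOfBilin_apply f ⟨v, hv⟩
    simp only [f, ContinuousLinearEquiv.apply_symm_apply,
      InnerProductSpace.toDual_symm_apply] at h1
    change -(cellForm hc (affinePair j β) v) = cellForm hc f.1 v at h1
    rw [map_add, add_apply, ← h1]
    ring
  refine ⟨fun γ => f.1 (γ, none), fun γ k => f.1 (γ, some k),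
    fun γ => (f.2 γ).1, fun γ => (f.2 γ).2, fun v V hv => ?_⟩
  -- Test functions may be normalized to mean zero, since only gradients enter the equation.
  let c : Fin m → ℝ := fun α => ∫ y in unitCell d, v α y
  have hvc : ∀ α, IsTorusH1 (fun y => v α y - c α) (V α) := fun α => (hv α).sub_const (c α)
  let v' : CellPair d m := WithLp.toLp 2 fun s => s.2.elim (hvc s.1).memLp.toLp
    fun k => ((hvc s.1).memLp_grad k).toLp
  have hV' : ∀ α k, v' (α, some k) =ᵐ[volume.restrict (unitCell d)] V α k := fun α k =>
    ((hvc α).memLp_grad k).coeFn_toLp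
  have hv' : v' ∈ torusH1 d m := by
    intro α
    refine ⟨(hvc α).congr_ae (hvc α).memLp.coeFn_toLp.symm fun k => (hV' α k).symm, ?_⟩
    refine (integral_congr_ae (hvc α).memLp.coeFn_toLp).trans ?_
    rw [integral_sub ((hv α).memLp.integrable (by norm_num)) (integrable_const _)]
    simp [c]
  have key := hf v' hv'
  rw [cellForm_apply] at key
  refine Eq.trans ?_ key
  change energyForm A ω δ (fun γ k y => f.1 (γ, some k) y + unitGrad j β γ k) V = _
  refine energyForm_congr_ae (fun γ k => ?_) (fun γ k => (hV' γ k).symm)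
  refine Filter.EventuallyEq.trans ?_
    (Lp.coeFn_add (f.1 (γ, some k)) (affinePair j β (γ, some k))).symm
  have h0 : affinePair j β (γ, some k) =ᵐ[volume.restrict (unitCell d)]
      fun _ => unitGrad j β γ k := MemLp.coeFn_toLp (memLp_const _)
  filter_upwards [h0] with y hy
  rw [Pi.add_apply, hy]

/-! ### Bounds for the homogenized tensor -/

/-- The homogenized coefficients in variational form: the constant field `∇(y_i e^α)` may be
corrected by any periodic gradient. -/
theorem homogenizedTensor_eq_energyForm {d m : ℕ} {A : (Fin d → ℝ) → CoeffTensor d m}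
    {ω : Set (Fin d → ℝ)} {δ : ℝ}
    (hc : ∀ i k α γ, MemLp (fun y => contrast ω δ y * A y i k α γ) ⊤
      (volume.restrict (unitCell d)))
    {χ : Fin d → Fin m → Fin m → (Fin d → ℝ) → ℝ}
    {G : Fin d → Fin m → Fin m → Fin d → (Fin d → ℝ) → ℝ}
    (hG : ∀ j β, IsCellSolution A ω δ j β (χ j β) (G j β)) (i j : Fin d) (α β : Fin m)
    {w : Fin m → (Fin d → ℝ) → ℝ} {W : Fin m → Fin d → (Fin d → ℝ) → ℝ}
    (hw : ∀ γ, IsTorusH1 (w γ) (W γ)) :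
    homogenizedTensor A ω δ G i j α β =
      energyForm A ω δ (fun γ k y => G j β γ k y + unitGrad j β γ k)
        (fun γ k y => W γ k y + unitGrad i α γ k) := by
  have hF : ∀ γ k, MemLp (fun y => G j β γ k y + unitGrad j β γ k) 2
      (volume.restrict (unitCell d)) := fun γ k =>
    (((hG j β).mem_H1 γ).memLp_grad k).add (memLp_const _)
  have h0 : energyForm A ω δ (fun γ k y => G j β γ k y + unitGrad j β γ k) W = 0 :=
    (hG j β).weak_eq w W hw
  rw [energyForm_add_right hc hF (fun γ k => (hw γ).memLp_grad k) (fun γ k => memLp_const _), h0,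
    zero_add, homogenizedTensor, energyForm]
  refine integral_congr_ae (Filter.Eventually.of_forall fun y => ?_)
  have e1 := fluxForm_add_left (A y) (fun γ k => G j β γ k y) (unitGrad j β) (unitGrad i α)
  rw [fluxForm_unitGrad, fluxForm_unitGrad_right (A y) fun γ k => G j β γ k y] at e1
  change contrast ω δ y * _ = contrast ω δ y * fluxForm (A y) (fun γ k => G j β γ k y + unitGrad j β γ k)
    (unitGrad i α)
  rw [e1, add_comm]

/-- The part of the Dirichlet energy of `F` outside the inclusion, which stays under control as
`δ → 0` and as `δ → ∞`. -/
noncomputable def outerEnergy {d m : ℕ} (ω : Set (Fin d → ℝ))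
    (F : Fin m → Fin d → (Fin d → ℝ) → ℝ) : ℝ :=
  ∑ k, ∑ γ, ∫ y in unitCell d, (unitCell d \ closure ω).indicator (fun y => F γ k y ^ 2) y

theorem measurableSet_unitCell_diff {d : ℕ} (ω : Set (Fin d → ℝ)) :
    MeasurableSet (unitCell d \ closure ω) :=
  (measurableSet_unitCell d).diff isClosed_closure.measurableSet

theorem outerEnergy_eq {d m : ℕ} {ω : Set (Fin d → ℝ)}
    {F : Fin m → Fin d → (Fin d → ℝ) → ℝ}
    (hF : ∀ γ k, MemLp (F γ k) 2 (volume.restrict (unitCell d))) :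
    outerEnergy ω F = ∫ y in unitCell d, ∑ k, ∑ γ,
      (unitCell d \ closure ω).indicator (fun y => F γ k y ^ 2) y := by
  have hi : ∀ k γ, Integrable ((unitCell d \ closure ω).indicator (fun y => F γ k y ^ 2))
      (volume.restrict (unitCell d)) := fun k γ =>
    (hF γ k).integrable_sq.indicator (measurableSet_unitCell_diff ω)
  rw [outerEnergy, integral_finsetSum _ fun k _ => integrable_finsetSum _ fun γ _ => hi k γ]
  refine Finset.sum_congr rfl fun k _ => ?_
  rw [integral_finsetSum _ fun γ _ => hi k γ]

theorem integrable_outerEnergy {d m : ℕ} {ω : Set (Fin d → ℝ)}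
    {F : Fin m → Fin d → (Fin d → ℝ) → ℝ}
    (hF : ∀ γ k, MemLp (F γ k) 2 (volume.restrict (unitCell d))) :
    Integrable (fun y => ∑ k, ∑ γ, (unitCell d \ closure ω).indicator (fun y => F γ k y ^ 2) y)
      (volume.restrict (unitCell d)) :=
  integrable_finsetSum _ fun k _ => integrable_finsetSum _ fun γ _ =>
    (hF γ k).integrable_sq.indicator (measurableSet_unitCell_diff ω)

/-- The contrast is `1` where the outer energy lives and nonnegative elsewhere, so the outer energy
is controlled for every `δ`. -/
theorem outerEnergy_le_energyForm {d m : ℕ} {μ : ℝ} (hμ : 0 < μ)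
    {A : (Fin d → ℝ) → CoeffTensor d m} (hA : IsStronglyElliptic μ A)
    {ω : Set (Fin d → ℝ)} {δ : ℝ} (hδ : 0 < δ)
    (hc : ∀ i k α γ, MemLp (fun y => contrast ω δ y * A y i k α γ) ⊤
      (volume.restrict (unitCell d)))
    {F : Fin m → Fin d → (Fin d → ℝ) → ℝ}
    (hF : ∀ γ k, MemLp (F γ k) 2 (volume.restrict (unitCell d))) :
    μ * outerEnergy ω F ≤ energyForm A ω δ F F := by
  rw [outerEnergy_eq hF, ← integral_const_mul, energyForm]
  refine integral_mono ((integrable_outerEnergy hF).const_mul μ)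
    (integrable_energyForm hc hF hF) fun y => ?_
  have h1 := (hA y fun k γ => F γ k y).1
  rw [tensorForm_eq_fluxForm, normSqVec] at h1
  have h2 : 0 ≤ μ * ∑ k, ∑ γ, F γ k y ^ 2 := by positivity
  by_cases hy : y ∈ unitCell d \ closure ω
  · simpa only [Set.indicator_of_mem hy, contrast_of_mem_diff hy, one_mul] using h1
  · simp only [Set.indicator_of_notMem hy, Finset.sum_const_zero, mul_zero]
    exact mul_nonneg (contrast_nonneg ω hδ y) (h2.trans h1)

/-- A bounded field that vanishes on the inclusion pairs with `F` through the outer energy of `F`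
only, whatever the contrast. -/
theorem abs_energyForm_le {d m : ℕ} {μ C₀ C₁ : ℝ} (hμ : 0 < μ)
    {A : (Fin d → ℝ) → CoeffTensor d m} (hA : ∀ y i k α γ, |A y i k α γ| ≤ C₀)
    {ω : Set (Fin d → ℝ)} {δ : ℝ}
    {F H : Fin m → Fin d → (Fin d → ℝ) → ℝ}
    (hF : ∀ γ k, MemLp (F γ k) 2 (volume.restrict (unitCell d)))
    (hH : ∀ γ k y, |H γ k y| ≤ C₁) (hH0 : ∀ γ k, ∀ y ∈ ω, H γ k y = 0) :
    |energyForm A ω δ F H| ≤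
      μ / 2 * outerEnergy ω F + d * m * ((d * m * (C₀ * C₁)) ^ 2 / (2 * μ)) := by
  set K : ℝ := d * m * ((d * m * (C₀ * C₁)) ^ 2 / (2 * μ)) with hK
  have hK0 : 0 ≤ K := by positivity
  have e : μ / 2 * outerEnergy ω F + K = ∫ y in unitCell d, (μ / 2 * ∑ k, ∑ γ,
      (unitCell d \ closure ω).indicator (fun y => F γ k y ^ 2) y + K) := by
    rw [integral_add ((integrable_outerEnergy hF).const_mul _) (integrable_const K),
      integral_const_mul, ← outerEnergy_eq hF]
    simp
  rw [e, energyForm, ← Real.norm_eq_abs]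
  refine norm_integral_le_of_norm_le (((integrable_outerEnergy hF).const_mul _).add
    (integrable_const K)) (Filter.Eventually.of_forall fun y => ?_)
  by_cases hyω : y ∈ ω
  · have : fluxForm (A y) (fun γ k => F γ k y) (fun γ k => H γ k y) = 0 := by
      simp [fluxForm, hH0 _ _ y hyω]
    have hn : y ∉ unitCell d \ closure ω := fun h => h.2 (subset_closure hyω)
    simpa [this, Set.indicator_of_notMem hn] using hK0
  · by_cases hy : y ∈ unitCell d \ closure ω
    · rw [contrast_of_mem_diff hy, one_mul]
      simp only [Set.indicator_of_mem hy]
      have h1 : ‖fluxForm (A y) (fun γ k => F γ k y) (fun γ k => H γ k y)‖ ≤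
          ∑ i : Fin d, ∑ k, ∑ α : Fin m, ∑ γ, C₀ * C₁ * |F γ k y| := by
        refine (norm_sum_le _ _).trans (Finset.sum_le_sum fun i _ => ?_)
        refine (norm_sum_le _ _).trans (Finset.sum_le_sum fun k _ => ?_)
        refine (norm_sum_le _ _).trans (Finset.sum_le_sum fun α _ => ?_)
        refine (norm_sum_le _ _).trans (Finset.sum_le_sum fun γ _ => ?_)
        rw [norm_mul, norm_mul, mul_right_comm]
        refine mul_le_mul_of_nonneg_right ?_ (norm_nonneg _)
        exact mul_le_mul (hA y i k α γ) (hH α i y) (norm_nonneg _)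
          ((abs_nonneg _).trans (hA y i k α γ))
      have h2 : ∑ i : Fin d, ∑ k, ∑ α : Fin m, ∑ γ, C₀ * C₁ * |F γ k y| =
          ∑ k, ∑ γ, (d * m * (C₀ * C₁)) * |F γ k y| := by
        simp only [Finset.sum_const, Finset.card_univ, Fintype.card_fin, nsmul_eq_mul,
          Finset.mul_sum]
        refine Finset.sum_congr rfl fun k _ => Finset.sum_congr rfl fun γ _ => ?_
        ring
      have h3 : ∑ k : Fin d, ∑ γ : Fin m, (d * m * (C₀ * C₁)) * |F γ k y| ≤
          ∑ k, ∑ γ, (μ / 2 * F γ k y ^ 2 + (d * m * (C₀ * C₁)) ^ 2 / (2 * μ)) := by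
        refine Finset.sum_le_sum fun k _ => Finset.sum_le_sum fun γ _ => ?_
        -- Young's inequality, with the defect as a square.
        have : μ / 2 * F γ k y ^ 2 + (d * m * (C₀ * C₁)) ^ 2 / (2 * μ) -
            (d * m * (C₀ * C₁)) * |F γ k y| =
            (μ * |F γ k y| - d * m * (C₀ * C₁)) ^ 2 / (2 * μ) := by
          field_simp
          rw [← sq_abs (F γ k y)]
          ring
        have h4 : 0 ≤ (μ * |F γ k y| - d * m * (C₀ * C₁)) ^ 2 / (2 * μ) := by positivity
        linarith
      have h4 : ∑ k : Fin d, ∑ γ : Fin m,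
          (μ / 2 * F γ k y ^ 2 + (d * m * (C₀ * C₁)) ^ 2 / (2 * μ)) =
          μ / 2 * ∑ k, ∑ γ, F γ k y ^ 2 + K := by
        simp only [Finset.sum_add_distrib, Finset.sum_const, Finset.card_univ, Fintype.card_fin,
          nsmul_eq_mul, Finset.mul_sum, hK]
        ring
      linarith
    · rw [contrast_of_notMem hyω]
      simpa [Set.indicator_of_notMem hy] using hK0

/-- Periodic correctors that turn the coordinate functions into constants on the inclusion. -/
theorem exists_flattening {d : ℕ} {ω : Set (Fin d → ℝ)} (hω : IsOpen ω) {r : ℝ} (hr0 : 0 < r)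
    (hr : r < 1 / 2) (hωr : ω ⊆ Metric.closedBall 0 r) (i : Fin d) :
    ∃ (w : (Fin d → ℝ) → ℝ) (W : Fin d → (Fin d → ℝ) → ℝ) (C : ℝ), IsTorusH1 w W ∧
      (∀ k, ∀ y ∈ ω, W k y = -if k = i then 1 else 0) ∧ ∀ k y, |W k y| ≤ C := by
  -- Balls of the sup norm are cubes, so the support of `θ` lies in the cell.
  let θ : ContDiffBump (0 : Fin d → ℝ) := ⟨r, (r + 1 / 2) / 2, hr0, by linarith⟩
  let w : (Fin d → ℝ) → ℝ := fun y => θ y * -y i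
  have hw : ContDiff ℝ 1 w := θ.contDiff.mul (by fun_prop)
  have hc : HasCompactSupport w := θ.hasCompactSupport.mul_right
  have hs : tsupport w ⊆ unitCell d := by
    refine (tsupport_mul_subset_left).trans ?_
    rw [θ.tsupport_eq]
    intro y hy k
    have h1 : |y k| ≤ (r + 1 / 2) / 2 :=
      (norm_le_pi_norm y k).trans (mem_closedBall_zero_iff.mp hy)
    exact abs_lt.mp (h1.trans_lt (by linarith))
  obtain ⟨C, hC⟩ := (hw.continuous_fderiv one_ne_zero).bounded_above_of_compact_support
    (hc.fderiv ℝ)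
  refine ⟨w, _, C, isTorusH1_of_hasCompactSupport hw hc hs, fun k y hy => ?_, fun k y => ?_⟩
  · have : w =ᶠ[nhds y] fun y => -y i := by
      filter_upwards [hω.mem_nhds hy] with z hz
      simp only [w, θ.one_of_mem_closedBall (hωr hz), one_mul]
    rw [this.fderiv_eq, (hasFDerivAt_apply (𝕜 := ℝ) i y).fun_neg.fderiv]
    simp [Pi.single_apply, eq_comm]
  · have h1 := (fderiv ℝ w y).le_opNorm (Pi.single k 1)
    have h2 : ‖(Pi.single k 1 : Fin d → ℝ)‖ = 1 := by
      rw [Pi.norm_single, norm_one]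
    rw [h2, mul_one] at h1
    exact h1.trans (hC y)

/-- Lower bound, uniform in `δ`: the form of the homogenized tensor is the energy of
`ξ · y + χ_ξ`, and its part outside the inclusion already sees every component of `ξ`. -/
theorem le_tensorForm_homogenizedTensor {d m : ℕ} (hd : 2 ≤ d) {μ : ℝ} (hμ : 0 < μ)
    {A : (Fin d → ℝ) → CoeffTensor d m} (hA : IsStronglyElliptic μ A)
    {ω : Set (Fin d → ℝ)} {r c₀ : ℝ} (hr : r < 1 / 2) (hωr : ω ⊆ Metric.closedBall 0 r)
    (hc₀ : ∀ j, c₀ ≤ ∫ y in unitCell d, slabFun r j y) {δ : ℝ} (hδ : 0 < δ)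
    (hc : ∀ i k α γ, MemLp (fun y => contrast ω δ y * A y i k α γ) ⊤
      (volume.restrict (unitCell d)))
    {χ : Fin d → Fin m → Fin m → (Fin d → ℝ) → ℝ}
    {G : Fin d → Fin m → Fin m → Fin d → (Fin d → ℝ) → ℝ}
    (hG : ∀ j β, IsCellSolution A ω δ j β (χ j β) (G j β)) (ξ : Fin d → Fin m → ℝ) :
    μ * c₀ * normSqVec ξ ≤ tensorForm (homogenizedTensor A ω δ G) ξ := by
  let F : Fin d × Fin m → Fin m → Fin d → (Fin d → ℝ) → ℝ := fun s γ k y =>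
    G s.1 s.2 γ k y + unitGrad s.1 s.2 γ k
  let Fξ : Fin m → Fin d → (Fin d → ℝ) → ℝ := fun γ k y => ∑ s, ξ s.1 s.2 * F s γ k y
  have hF : ∀ s γ k, MemLp (F s γ k) 2 (volume.restrict (unitCell d)) := fun s γ k =>
    (((hG s.1 s.2).mem_H1 γ).memLp_grad k).add (memLp_const _)
  have hFξ : ∀ γ k, MemLp (Fξ γ k) 2 (volume.restrict (unitCell d)) := fun γ k =>
    memLp_finsetSum _ fun s _ => (hF s γ k).const_mul _
  have hform : tensorForm (homogenizedTensor A ω δ G) ξ = energyForm A ω δ Fξ Fξ := by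
    rw [energyForm_sum_left hc hF hFξ]
    have e : ∀ s, energyForm A ω δ (F s) Fξ =
        ∑ t : Fin d × Fin m, ξ t.1 t.2 * energyForm A ω δ (F s) (F t) := fun s =>
      energyForm_sum_right hc (hF s) hF _
    simp only [e, Fintype.sum_prod_type, tensorForm,
      Finset.mul_sum]
    rw [Finset.sum_comm]
    refine Finset.sum_congr rfl fun j _ => ?_
    symm
    rw [Finset.sum_comm]
    refine Finset.sum_congr rfl fun i _ => ?_
    rw [Finset.sum_comm]
    refine Finset.sum_congr rfl fun α _ => Finset.sum_congr rfl fun β _ => ?_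
    rw [homogenizedTensor_eq_energyForm hc hG i j α β (hG i α).mem_H1]
    ring
  have hFξ_eq : ∀ γ k y, Fξ γ k y = ∑ s : Fin d × Fin m, ξ s.1 s.2 * G s.1 s.2 γ k y + ξ k γ := by
    intro γ k y
    simp only [Fξ, F, mul_add, Finset.sum_add_distrib]
    congr 1
    rw [Finset.sum_eq_single (k, γ)]
    · simp [unitGrad]
    · rintro ⟨j, β⟩ _ hne
      have : ¬(k = j ∧ γ = β) := fun h => hne (by rw [h.1, h.2])
      simp [unitGrad, this]
    · simp
  have : Nontrivial (Fin d) := Fin.nontrivial_iff_two_le.mpr hd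
  have houter : c₀ * normSqVec ξ ≤ outerEnergy ω Fξ := by
    rw [normSqVec, outerEnergy, Finset.mul_sum]
    refine Finset.sum_le_sum fun k _ => ?_
    rw [Finset.mul_sum]
    refine Finset.sum_le_sum fun γ _ => ?_
    -- A second direction exists because `2 ≤ d`.
    obtain ⟨j, hj⟩ := exists_ne k
    have h1 := (IsTorusH1.sum (fun s : Fin d × Fin m => (hG s.1 s.2).mem_H1 γ)
      fun s => ξ s.1 s.2).slope_le hr hωr hj.symm (ξ k γ)
    simp only [← hFξ_eq] at h1
    refine le_trans ?_ h1
    rw [mul_comm]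
    exact mul_le_mul_of_nonneg_left (hc₀ j) (sq_nonneg _)
  rw [hform, mul_assoc]
  exact (mul_le_mul_of_nonneg_left houter hμ.le).trans
    (outerEnergy_le_energyForm hμ hA hδ hc hFξ)

/-- Upper bound on each homogenized coefficient, uniform in `δ`: pairing with the flattened
coordinate functions, which are constant on the inclusion, first bounds the outer energy of each
corrected coordinate function by absorption, and then the coefficients. -/
theorem abs_homogenizedTensor_le {d m : ℕ} {μ C₀ C₁ : ℝ} (hμ : 0 < μ)
    {A : (Fin d → ℝ) → CoeffTensor d m} (hA : IsStronglyElliptic μ A)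
    (hC₀ : ∀ y i k α γ, |A y i k α γ| ≤ C₀) {ω : Set (Fin d → ℝ)}
    {w : Fin d → (Fin d → ℝ) → ℝ} {W : Fin d → Fin d → (Fin d → ℝ) → ℝ}
    (hw : ∀ i, IsTorusH1 (w i) (W i))
    (hWω : ∀ i k, ∀ y ∈ ω, W i k y = -if k = i then 1 else 0)
    (hW : ∀ i k y, |W i k y| ≤ C₁) {δ : ℝ} (hδ : 0 < δ)
    (hc : ∀ i k α γ, MemLp (fun y => contrast ω δ y * A y i k α γ) ⊤
      (volume.restrict (unitCell d)))
    {χ : Fin d → Fin m → Fin m → (Fin d → ℝ) → ℝ}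
    {G : Fin d → Fin m → Fin m → Fin d → (Fin d → ℝ) → ℝ}
    (hG : ∀ j β, IsCellSolution A ω δ j β (χ j β) (G j β)) (i j : Fin d) (α β : Fin m) :
    |homogenizedTensor A ω δ G i j α β| ≤
      2 * (d * m * ((d * m * (C₀ * (C₁ + 1))) ^ 2 / (2 * μ))) := by
  have hC₁ : 0 ≤ C₁ := (abs_nonneg _).trans (hW i i 0)
  let F : Fin m → Fin d → (Fin d → ℝ) → ℝ := fun γ k y => G j β γ k y + unitGrad j β γ k
  have hF : ∀ γ k, MemLp (F γ k) 2 (volume.restrict (unitCell d)) := fun γ k =>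
    (((hG j β).mem_H1 γ).memLp_grad k).add (memLp_const _)
  set K : ℝ := d * m * ((d * m * (C₀ * (C₁ + 1))) ^ 2 / (2 * μ)) with hK
  have key : ∀ i α, |homogenizedTensor A ω δ G i j α β| ≤ μ / 2 * outerEnergy ω F + K := by
    intro i α
    have hwα : ∀ γ, IsTorusH1 (fun y => (if γ = α then 1 else 0) * w i y)
        (fun k y => (if γ = α then 1 else 0) * W i k y) := fun γ => (hw i).const_mul _
    rw [homogenizedTensor_eq_energyForm hc hG i j α β hwα]
    refine abs_energyForm_le hμ hC₀ hF (fun γ k y => ?_) (fun γ k y hy => ?_)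
    · by_cases hγ : γ = α
      · simp only [hγ, unitGrad, if_true, one_mul, and_true]
        refine (abs_add_le _ _).trans (add_le_add (hW i k y) ?_)
        split_ifs <;> simp
      · simp [hγ, unitGrad]
        positivity
    · by_cases hγ : γ = α
      · simp [hγ, unitGrad, hWω i k y hy]
      · simp [hγ, unitGrad]
  have h1 : μ * outerEnergy ω F ≤ homogenizedTensor A ω δ G j j β β := by
    rw [homogenizedTensor_eq_energyForm hc hG j j β β (hG j β).mem_H1]
    exact outerEnergy_le_energyForm hμ hA hδ hc hF
  -- Diagonal case: `μ X ≤ μ / 2 * X + K` for the outer energy `X` of `F`, so `μ / 2 * X ≤ K`.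
  have h2 := (le_abs_self _).trans (key j β)
  have h3 := key i α
  linarith

theorem tensorNorm_le {d m : ℕ} {T : CoeffTensor d m} {C : ℝ} (hC : 0 ≤ C)
    (hT : ∀ i j α β, |T i j α β| ≤ C) : tensorNorm T ≤ d * m * C := by
  refine Real.sqrt_le_iff.mpr ⟨by positivity, ?_⟩
  calc ∑ i, ∑ j, ∑ α, ∑ β, T i j α β ^ 2
      ≤ ∑ _i : Fin d, ∑ _j : Fin d, ∑ _α : Fin m, ∑ _β : Fin m, C ^ 2 := by
        refine Finset.sum_le_sum fun i _ => Finset.sum_le_sum fun j _ =>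
          Finset.sum_le_sum fun α _ => Finset.sum_le_sum fun β _ => ?_
        exact sq_le_sq.mpr ((hT i j α β).trans (le_abs_self C))
    _ = (d * m * C) ^ 2 := by
        simp only [Finset.sum_const, Finset.card_univ, Fintype.card_fin, nsmul_eq_mul]
        ring

theorem theorem3p5 {d m : ℕ} (hd : 2 ≤ d) (hm : 1 ≤ m)
    {ω : Set (Fin d → ℝ)} (hω : IsInclusion ω)
    {μ M : ℝ} (hμ : 0 < μ) (hM : 0 ≤ M) :
    ∃ μ₁ : ℝ, 0 < μ₁ ∧
      ∀ A : (Fin d → ℝ) → CoeffTensor d m,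
        Measurable A → HasSkewBound M A → IsStronglyElliptic μ A → IsLatticePeriodic A →
        ∀ δ : ℝ, 0 < δ →
          (∃ (χ : Fin d → Fin m → Fin m → (Fin d → ℝ) → ℝ)
              (G : Fin d → Fin m → Fin m → Fin d → (Fin d → ℝ) → ℝ),
              ∀ j β, IsCellSolution A ω δ j β (χ j β) (G j β)) ∧
          ∀ (χ : Fin d → Fin m → Fin m → (Fin d → ℝ) → ℝ)
            (G : Fin d → Fin m → Fin m → Fin d → (Fin d → ℝ) → ℝ),
            (∀ j β, IsCellSolution A ω δ j β (χ j β) (G j β)) →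
              tensorNorm (homogenizedTensor A ω δ G) ≤ μ₁⁻¹ ∧
              ∀ ξ : Fin d → Fin m → ℝ,
                μ₁ * normSqVec ξ ≤ tensorForm (homogenizedTensor A ω δ G) ξ := by
  obtain ⟨r, hr0, hr, hωr⟩ := hω.exists_closedBall
  choose w W C hw hWω hW using exists_flattening hω.isOpen hr0 hr hωr
  have hWle : ∀ i k y, |W i k y| ≤ ∑ l, |C l| := fun i k y =>
    (hW i k y).trans ((le_abs_self _).trans
      (Finset.single_le_sum (f := fun l => |C l|) (fun _ _ => abs_nonneg _) (Finset.mem_univ i)))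
  obtain ⟨j₀, -, hj₀⟩ := Finset.exists_min_image Finset.univ
    (fun j : Fin d => ∫ y in unitCell d, slabFun r j y) ⟨⟨0, by omega⟩, Finset.mem_univ _⟩
  have hc₀ := integral_slabFun_pos hr0 hr j₀
  set K : ℝ := 2 * (d * m * ((d * m * ((2 * μ⁻¹ + M) * (∑ l, |C l| + 1))) ^ 2 / (2 * μ))) with hK
  have hK0 : 0 ≤ K := by positivity
  -- The summand `1` makes the bound invertible.
  refine ⟨min (μ * ∫ y in unitCell d, slabFun r j₀ y) (d * m * K + 1)⁻¹,
    lt_min (mul_pos hμ hc₀) (by positivity), fun A hAm hS hA _ δ hδ => ?_⟩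
  have hc := memLp_contrast_coeff hμ hAm hA hS hω.isOpen hδ
  refine ⟨?_, fun χ G hG => ⟨?_, fun ξ => ?_⟩⟩
  · choose χ G hG using exists_isCellSolution hμ hA hω hδ hc
    exact ⟨χ, G, hG⟩
  · have h1 := tensorNorm_le hK0 (abs_homogenizedTensor_le hμ hA (abs_coeff_le hμ hA hS) hw hWω
      hWle hδ hc hG)
    refine h1.trans ((lt_add_one _).le.trans ?_)
    exact (le_inv_comm₀ (by positivity) (lt_min (mul_pos hμ hc₀) (by positivity))).mpr
      (min_le_right _ _)
  · have h1 : 0 ≤ normSqVec ξ := by unfold normSqVec; positivity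
    exact (mul_le_mul_of_nonneg_right (min_le_left _ _) h1).trans
      (le_tensorForm_homogenizedTensor hd hμ hA hr hωr (fun j => hj₀ j (Finset.mem_univ j)) hδ hc
        hG ξ)
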